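/- Let $d\ge 1$ and write points of $\mathbb R^{d+1}$ as $(t,x)$, $t\in\mathbb R$, $x\in\mathbb R^d$. For $\rho\in(0,\infty]$ put $$C_\rho(t,x)=\{(s,y)\in\mathbb R^{d+1}:|x-y|<\rho,\ t\le s<t+\rho^2\},\qquad C_\rho=C_\rho(0,0),$$ so that $C_\infty=[0,\infty)\times\mathbb R^d$. For $p_1,p_2\in(1,\infty)$ and a measurable function $f$ on $\mathbb R^{d+1}$ let $$\|f\|_{L_{p_1,p_2}}=\Big(\int_{\mathbb R}\Big(\int_{\mathbb R^d}|f(t,x)|^{p_1}\,dx\Big)^{p_2/p_1}dt\Big)^{1/p_2},$$ and for $0<\gamma\le d/p_1+2/p_2$ and $Q\subset\mathbb R^{d+1}$ let $$\|f\|_{E_{p_1,p_2,\gamma}(Q)}=\sup_{0<\rho<\infty,\ (t,x)\in Q}\rho^{\gamma}\,\frac{\|f\,I_Q I_{C_\rho(t,x)}\|_{L_{p_1,p_2}}}{\|I_{C_\rho(t,x)}\|_{L_{p_1,p_2}}}.$$ Let $Du$ and $D^2u$ be the gradient and the Hessian of $u$ with respect to $x$, with Euclidean norms $|Du|$ and $|D^2u|=(\sum_{i,j}|D_{ij}u|^2)^{1/2}$.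 **Theorem.** Let $q_1,q_2\in(1,\infty)$, $1<\beta\le d/q_1+2/q_2$, and let $r_1,r_2$ be defined by $r_i(\beta-1)=q_i\beta$, $i=1,2$. Then there is a constant $N<\infty$, depending only on $d,q_1,q_2,\beta$, such that for every $R\in(0,\infty]$ and every $u\in C_0^\infty(\mathbb R^{d+1})$ $$\|Du\|_{E_{r_1,r_2,\beta-1}(C_R)}\le N\,\big\||\partial_tu|+|D^2u|\big\|_{E_{q_1,q_2,\beta}(C_R)}+N R^{-2}\|u\|_{E_{q_1,q_2,\beta}(C_R)},$$ where $R^{-2}=0$ if $R=\infty$. -/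

import Mathlib

open MeasureTheory
open scoped ENNReal NNReal

noncomputable section

namespace ParabolicMorrey

/-- `ℝ^{d+1}`, the space of points `z = (t, x)`, `t ∈ ℝ`, `x ∈ ℝ^d` (Euclidean). -/
abbrev SpaceTime (d : ℕ) : Type := ℝ × EuclideanSpace ℝ (Fin d)

variable {d : ℕ} {F : Type*} [NormedAddCommGroup F]

/-- The parabolic cylinder `C_ρ(t, x) = {(s, y) : |x - y| < ρ, t ≤ s < t + ρ²}`. The radius may be
infinite, and then the cylinder is `[t, ∞) × ℝ^d`. -/
def cylinder (ρ : ℝ≥0∞) (z : SpaceTime d) : Set (SpaceTime d) :=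
  {w | edist z.2 w.2 < ρ ∧ z.1 ≤ w.1 ∧ ENNReal.ofReal (w.1 - z.1) < ρ ^ 2}

theorem mem_cylinder_coe (ρ : ℝ≥0) (z w : SpaceTime d) :
    w ∈ cylinder (ρ : ℝ≥0∞) z ↔ dist z.2 w.2 < ρ ∧ z.1 ≤ w.1 ∧ w.1 < z.1 + (ρ : ℝ) ^ 2 := by
  have h1 : edist z.2 w.2 < (ρ : ℝ≥0∞) ↔ dist z.2 w.2 < ρ := by
    rw [edist_nndist, ENNReal.coe_lt_coe, ← NNReal.coe_lt_coe, coe_nndist]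
  have h2 : z.1 ≤ w.1 → (ENNReal.ofReal (w.1 - z.1) < (ρ : ℝ≥0∞) ^ 2 ↔
      w.1 < z.1 + (ρ : ℝ) ^ 2) := by
    intro h
    rw [← ENNReal.coe_pow, ← ENNReal.ofReal_coe_nnreal,
      ENNReal.ofReal_lt_ofReal_iff_of_nonneg (by linarith)]
    push_cast
    constructor <;> intro h <;> linarith
  simp only [cylinder, Set.mem_ofPred_eq]
  rw [h1]
  constructor
  · rintro ⟨a, b, c⟩
    exact ⟨a, b, (h2 b).1 c⟩
  · rintro ⟨a, b, c⟩
    exact ⟨a, b, (h2 b).2 c⟩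

theorem mem_cylinder_top (z w : SpaceTime d) : w ∈ cylinder ⊤ z ↔ z.1 ≤ w.1 := by
  simp [cylinder, edist_lt_top]

/-- The mixed norm
`‖f‖_{L_{q₁,q₂}} = (∫_ℝ (∫_{ℝ^d} |f(t, x)|^{q₁} dx)^{q₂/q₁} dt)^{1/q₂} ∈ [0, ∞]`. -/
def mixedNorm (q₁ q₂ : ℝ) (f : SpaceTime d → F) : ℝ≥0∞ :=
  (∫⁻ t : ℝ, (∫⁻ x : EuclideanSpace ℝ (Fin d), ‖f (t, x)‖ₑ ^ q₁) ^ (q₂ / q₁)) ^ (1 / q₂)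

/-- The normalized mixed norm `‖I_Γ‖_{L_{q₁,q₂}}⁻¹ ‖f I_Γ‖_{L_{q₁,q₂}}` over a set `Γ`. -/
def mixedNormAvg (q₁ q₂ : ℝ) (Γ : Set (SpaceTime d)) (f : SpaceTime d → F) : ℝ≥0∞ :=
  (mixedNorm q₁ q₂ (Γ.indicator fun _ => (1 : ℝ)))⁻¹ * mixedNorm q₁ q₂ (Γ.indicator f)

/-- The mixed-norm parabolic Morrey norm `‖f‖_{E_{q₁,q₂,β}(Q)}`: the supremum over
`0 < ρ < ∞` and `z ∈ Q` of `ρ^β` times the normalized norm of `I_Q f` over `C_ρ(z)`. -/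
def morreyNorm (q₁ q₂ β : ℝ) (Q : Set (SpaceTime d)) (f : SpaceTime d → F) : ℝ≥0∞ :=
  ⨆ (ρ : ℝ≥0) (_ : 0 < ρ) (z : SpaceTime d) (_ : z ∈ Q),
    (ρ : ℝ≥0∞) ^ β * mixedNormAvg q₁ q₂ (cylinder ρ z) (Q.indicator f)

/-- The time derivative `∂_t u`. -/
def timeDeriv (u : SpaceTime d → ℝ) (z : SpaceTime d) : ℝ :=
  deriv (fun s => u (s, z.2)) z.1

/-- The spatial partial derivative `D_i u = ∂u/∂x^i`. -/
def spaceDeriv (i : Fin d) (u : SpaceTime d → ℝ) (z : SpaceTime d) : ℝ :=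
  fderiv ℝ (fun y => u (z.1, y)) z.2 (EuclideanSpace.single i 1)

/-- The spatial gradient `Du = (D_1 u, …, D_d u)`, with the Euclidean norm. -/
def spaceGrad (u : SpaceTime d → ℝ) (z : SpaceTime d) : EuclideanSpace ℝ (Fin d) :=
  WithLp.toLp 2 fun i => spaceDeriv i u z

/-- The spatial Hessian `D²u = (D_i D_j u)`, with the Euclidean (Hilbert–Schmidt) norm. -/
def spaceHess (u : SpaceTime d → ℝ) (z : SpaceTime d) : EuclideanSpace ℝ (Fin d × Fin d) :=
  WithLp.toLp 2 fun p => spaceDeriv p.1 (spaceDeriv p.2 u) z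

end ParabolicMorrey

end

/-!
Averaging `D_i u(z)` over the paths `l ↦ z + (l² a, l (ξ + e))` with weight `ψ(ξ)`, and integrating
by parts in `ξ` to move `D_i` off the factors `u` and `∂ₜu`, bounds `|Du(z)|` by the means of
`g = |∂ₜu| + |D²u|` over the parabolic cylinders of radius about `l` around `z`, integrated over the
scales `0 < l ≤ L`, plus `L⁻¹` times a mean of `|u|` at scale `L`. The drift `(a, e)` keeps the
paths inside `C_R`, so only values in `C_R` enter. For `R < ∞` one takes `L = R / 2` and bounds the
mean of `u` by its Morrey norm; for `R = ∞` that term tends to `0` as `L → ∞`, because `u` is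
bounded.

The integral over all scales is a parabolic Riesz potential of order one. The mean of `g` at scale
`l` is at most the maximal function `M g` and at most a multiple of `l ^ (-β)` times the Morrey norm
`‖g‖`. Using the first bound for small `l` and the second for large `l`, Hedberg's argument gives a
potential of size `(M g) ^ (1 - 1 / β) * ‖g‖ ^ (1 / β)`. On a cylinder of radius `ρ` this is applied
to the part of `g` near the cylinder, and the scales `l ≥ ρ` contribute `ρ ^ (1 - β) * ‖g‖`. Since
`(1 - 1 / β) rᵢ = qᵢ`, what remains is the boundedness of `M` on `L_{q₁,q₂}`.

For `q₁ < q₂` this follows by duality in `t` from the weighted inequality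
`∫ (M f) ^ p * w ≤ C * ∫ f ^ p * M w`. For `q₂ ≤ q₁` one sets `F(t) = ‖f(t, ·)‖_{q₁}` and factors
`f` as `k ^ (q₂ / q₁) * F ^ (1 - q₂ / q₁)` with `‖k(t, ·)‖_{q₂} = F(t)`; Hölder's inequality then
gives `M f ≤ (M k) ^ (q₂ / q₁) * (M F) ^ (1 - q₂ / q₁)`, where both factors are controlled by the
unmixed inequality with exponent `q₂`.
-/

noncomputable section

namespace ParabolicMorrey

section Maximal

variable {X : Type*} [MeasurableSpace X] {μ : Measure X} {f : X → ℝ≥0∞}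

theorem setLIntegral_Ioi_rpow_eq_top (s : ℝ) :
    ∫⁻ l in Set.Ioi (0 : ℝ), ENNReal.ofReal l ^ (s - 1) = ⊤ := by
  by_contra h
  refine not_integrableOn_Ioi_rpow (s - 1) ⟨by fun_prop, ?_⟩
  refine (setLIntegral_mono' measurableSet_Ioi fun l hl => ?_).trans_lt (lt_top_iff_ne_top.2 h)
  rw [Real.enorm_of_nonneg (Real.rpow_nonneg (le_of_lt hl) _), ENNReal.ofReal_rpow_of_pos hl]

theorem lintegral_rpow_eq_lintegral_measure_lt (hf : Measurable f) {s : ℝ} (hs : 0 < s) :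
    ∫⁻ z, f z ^ s ∂μ = ENNReal.ofReal s * ∫⁻ l in Set.Ioi (0 : ℝ),
      ENNReal.ofReal l ^ (s - 1) * μ {z | ENNReal.ofReal l < f z} := by
  by_cases hfin : ∀ᵐ z ∂μ, f z ≠ ⊤
  · have layer := lintegral_rpow_eq_lintegral_meas_lt_mul μ
      (Filter.Eventually.of_forall fun z => ENNReal.toReal_nonneg (a := f z))
      hf.ennreal_toReal.aemeasurable hs
    have hpow : ∫⁻ z, f z ^ s ∂μ = ∫⁻ z, ENNReal.ofReal ((f z).toReal ^ s) ∂μ := by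
      refine lintegral_congr_ae (hfin.mono fun z hz => ?_)
      dsimp only
      rw [← ENNReal.ofReal_rpow_of_nonneg ENNReal.toReal_nonneg hs.le, ENNReal.ofReal_toReal hz]
    rw [hpow, layer]
    congr 1
    refine setLIntegral_congr_fun measurableSet_Ioi fun l hl => ?_
    have hlevel : μ {z | l < (f z).toReal} = μ {z | ENNReal.ofReal l < f z} :=
      measure_congr (hfin.mono fun z hz =>
        propext (ENNReal.ofReal_lt_iff_lt_toReal (le_of_lt hl) hz).symm)
    rw [hlevel, mul_comm, ENNReal.ofReal_rpow_of_pos hl]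
  · have hpos : μ {z | f z = ⊤} ≠ 0 := by simpa [ae_iff] using hfin
    have hle : ∀ l : ℝ, μ {z | f z = ⊤} ≤ μ {z | ENNReal.ofReal l < f z} := fun l =>
      measure_mono fun z hz => by simp_all
    have hright : ∫⁻ l in Set.Ioi (0 : ℝ),
        ENNReal.ofReal l ^ (s - 1) * μ {z | ENNReal.ofReal l < f z} = ⊤ := by
      refine top_le_iff.1 (le_trans ?_ (lintegral_mono fun l => mul_le_mul_right (hle l) _))
      rw [lintegral_mul_const _ (by fun_prop), setLIntegral_Ioi_rpow_eq_top s,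
        ENNReal.top_mul hpos]
    have hleft : ∫⁻ z, f z ^ s ∂μ = ⊤ := by
      refine lintegral_eq_top_of_measure_eq_top_ne_zero (hf.pow_const s).aemeasurable ?_
      simpa [ENNReal.rpow_eq_top_iff_of_pos hs] using hpos
    rw [hleft, hright, ENNReal.mul_top (by simpa using hs)]

theorem rpow_eq_rpow_sub_one_mul (a : ℝ≥0∞) {p : ℝ} (hp : 1 ≤ p) : a ^ p = a ^ (p - 1) * a := by
  nth_rw 3 [← ENNReal.rpow_one a]
  rw [← ENNReal.rpow_add_of_nonneg _ _ (by linarith) zero_le_one, sub_add_cancel]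

theorem lintegral_rpow_le_of_mul_measure_lt_le {ν : Measure X} {g : X → ℝ≥0∞} {C : ℝ≥0∞}
    (hg : Measurable g) (hf : Measurable f) {p : ℝ} (hp : 1 < p)
    (h : ∀ l : ℝ, 0 < l → ENNReal.ofReal l * ν {z | ENNReal.ofReal l < g z} ≤
      C * μ {z | ENNReal.ofReal l < f z}) :
    ∫⁻ z, g z ^ p ∂ν ≤ ENNReal.ofReal (p / (p - 1)) * C * ∫⁻ z, f z ^ (p - 1) ∂μ := by
  have hp1 : 0 < p - 1 := by linarith
  have hanti : Antitone fun l : ℝ => μ {z | ENNReal.ofReal l < f z} := fun a b hab =>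
    measure_mono fun z hz => lt_of_le_of_lt (ENNReal.ofReal_le_ofReal hab) hz
  have hmeas : Measurable fun l : ℝ =>
      ENNReal.ofReal l ^ (p - 1 - 1) * μ {z | ENNReal.ofReal l < f z} :=
    (ENNReal.measurable_ofReal.pow_const _).mul hanti.measurable
  calc ∫⁻ z, g z ^ p ∂ν
      = ENNReal.ofReal p * ∫⁻ l in Set.Ioi (0 : ℝ),
          ENNReal.ofReal l ^ (p - 1) * ν {z | ENNReal.ofReal l < g z} :=
        lintegral_rpow_eq_lintegral_measure_lt hg (by linarith)
    _ ≤ ENNReal.ofReal p * ∫⁻ l in Set.Ioi (0 : ℝ),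
          C * (ENNReal.ofReal l ^ (p - 1 - 1) * μ {z | ENNReal.ofReal l < f z}) := by
        gcongr _ * ?_
        refine setLIntegral_mono' measurableSet_Ioi fun l hl => ?_
        have hpow : ENNReal.ofReal l ^ (p - 1) =
            ENNReal.ofReal l ^ (p - 1 - 1) * ENNReal.ofReal l := by
          rw [show p - 1 = p - 1 - 1 + 1 by ring, ENNReal.rpow_add _ _ (by simpa using hl)
            ENNReal.ofReal_ne_top, ENNReal.rpow_one, add_sub_cancel_right]
        rw [hpow, mul_assoc, mul_left_comm C]
        exact mul_le_mul_right (h l hl) _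
    _ = ENNReal.ofReal (p / (p - 1)) * ENNReal.ofReal (p - 1) * (C * ∫⁻ l in Set.Ioi (0 : ℝ),
          ENNReal.ofReal l ^ (p - 1 - 1) * μ {z | ENNReal.ofReal l < f z}) := by
        rw [lintegral_const_mul _ hmeas, ENNReal.ofReal_div_of_pos hp1,
          ENNReal.div_mul_cancel (by simpa using hp1) ENNReal.ofReal_ne_top]
    _ = ENNReal.ofReal (p / (p - 1)) * C * ∫⁻ z, f z ^ (p - 1) ∂μ := by
        rw [lintegral_rpow_eq_lintegral_measure_lt hf hp1]
        ring

/-- An abstract system of dyadic balls: `B z k` plays the role of the ball of radius `2 ^ k` about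
`z`, and three dyadic steps make up for the triangle inequality. -/
structure IsBallSystem (B : X → ℤ → Set X) : Prop where
  mem : ∀ z k, z ∈ B z k
  engulf : ∀ z w k l, k ≤ l → (B z k ∩ B w l).Nonempty → B z k ⊆ B w (l + 3)
  measurableSet_setOf_mem : ∀ k, MeasurableSet {p : X × X | p.2 ∈ B p.1 k}

/-- A ball system for which the measure `μ` is finite and doubling, with constant `D` for three
dyadic steps. -/
structure IsDoublingBallSystem (μ : Measure X) (B : X → ℤ → Set X) (D : ℝ≥0∞) : Prop
    extends IsBallSystem B where
  measure_ne_top : ∀ z k, μ (B z k) ≠ ⊤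
  measure_add_three_le : ∀ z k, μ (B z (k + 3)) ≤ D * μ (B z k)

/-- The centred maximal function of `f` with respect to the measure `μ` and the balls `B`. -/
def maximalFn (μ : Measure X) (B : X → ℤ → Set X) (f : X → ℝ≥0∞) (z : X) : ℝ≥0∞ :=
  ⨆ k, ⨍⁻ w in B z k, f w ∂μ

variable {B : X → ℤ → Set X} {D : ℝ≥0∞} {g w : X → ℝ≥0∞}

theorem setLAverage_le_maximalFn (z : X) (k : ℤ) :
    ⨍⁻ w in B z k, f w ∂μ ≤ maximalFn μ B f z :=
  le_iSup (fun k => ⨍⁻ w in B z k, f w ∂μ) k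

theorem setLAverage_mono (s : Set X) (h : f ≤ g) : ⨍⁻ w in s, f w ∂μ ≤ ⨍⁻ w in s, g w ∂μ :=
  lintegral_mono h

theorem setLAverage_const_le (s : Set X) (c : ℝ≥0∞) : ⨍⁻ _ in s, c ∂μ ≤ c := by
  rw [setLAverage_eq, setLIntegral_const]
  exact ENNReal.div_le_of_le_mul le_rfl

theorem measure_ne_zero_of_lt_setLAverage {s : Set X} {l : ℝ≥0∞} (h : l < ⨍⁻ y in s, f y ∂μ) :
    μ s ≠ 0 := fun h0 => by
  simp [setLAverage_eq, setLIntegral_measure_zero _ _ h0] at h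

theorem maximalFn_const_le (c : ℝ≥0∞) (z : X) : maximalFn μ B (fun _ => c) z ≤ c :=
  iSup_le fun _ => setLAverage_const_le _ c

theorem maximalFn_le_add_of_le_add {c : ℝ≥0∞} (h : ∀ z, g z ≤ f z + c) (z : X) :
    maximalFn μ B g z ≤ maximalFn μ B f z + c :=
  iSup_le fun k => calc
    ⨍⁻ w in B z k, g w ∂μ ≤ ⨍⁻ w in B z k, (f w + c) ∂μ := setLAverage_mono _ h
    _ = ⨍⁻ w in B z k, f w ∂μ + ⨍⁻ _ in B z k, c ∂μ := lintegral_add_right _ measurable_const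
    _ ≤ maximalFn μ B f z + c :=
      add_le_add (setLAverage_le_maximalFn z k) (setLAverage_const_le _ c)

namespace IsBallSystem

theorem measurableSet (hB : IsBallSystem B) (z : X) (k : ℤ) : MeasurableSet (B z k) :=
  measurable_prodMk_left (hB.measurableSet_setOf_mem k)

theorem subset_add_three_of_mem (hB : IsBallSystem B) {x z : X} {k : ℤ} (hx : x ∈ B z k) :
    B x k ⊆ B z (k + 3) :=
  hB.engulf x z k k le_rfl ⟨x, hB.mem x k, hx⟩

theorem add_three_subset_add_six_of_mem (hB : IsBallSystem B) {x z : X} {k : ℤ}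
    (hx : x ∈ B z k) : B z (k + 3) ⊆ B x (k + 3 + 3) :=
  hB.engulf z x (k + 3) (k + 3) le_rfl
    ⟨x, hB.subset_add_three_of_mem (hB.mem z k) hx, hB.mem x _⟩

theorem measurable_setLIntegral [SFinite μ] (hB : IsBallSystem B) (hf : Measurable f) (k : ℤ) :
    Measurable fun z => ∫⁻ w in B z k, f w ∂μ := by
  have hindicator : ∀ z, ∫⁻ w in B z k, f w ∂μ =
      ∫⁻ w, {p : X × X | p.2 ∈ B p.1 k}.indicator (fun p => f p.2) (z, w) ∂μ := fun z => by
    rw [← lintegral_indicator (hB.measurableSet z k)]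
    rfl
  simp_rw [hindicator]
  exact ((hf.comp measurable_snd).indicator (hB.measurableSet_setOf_mem k)).lintegral_prod_right'

theorem measurable_maximalFn [SFinite μ] (hB : IsBallSystem B) (hf : Measurable f) :
    Measurable (maximalFn μ B f) := by
  refine Measurable.iSup fun k => ?_
  simp_rw [setLAverage_eq]
  exact (hB.measurable_setLIntegral hf k).div
    (measurable_measure_prodMk_left (hB.measurableSet_setOf_mem k))

theorem exists_disjoint_subfamily (hB : IsBallSystem B) (S : Set (X × ℤ)) {n : ℤ}
    (hn : ∀ p ∈ S, p.2 ≤ n) :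
    ∃ u ⊆ S, u.PairwiseDisjoint (fun p => B p.1 p.2) ∧
      ∀ p ∈ S, ∃ q ∈ u, B p.1 p.2 ⊆ B q.1 (q.2 + 3) := by
  obtain ⟨u, huS, hdisj, hcover⟩ := Vitali.exists_disjoint_subfamily_covering_enlargement
    (fun p : X × ℤ => B p.1 p.2) S (fun p => (2 : ℝ) ^ p.2) (3 / 2) (by norm_num)
    (fun p _ => by positivity) ((2 : ℝ) ^ n)
    (fun p hp => zpow_le_zpow_right₀ one_le_two (hn p hp)) (fun p _ => ⟨p.1, hB.mem _ _⟩)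
  refine ⟨u, huS, hdisj, fun p hp => ?_⟩
  obtain ⟨q, hq, hne, hle⟩ := hcover p hp
  refine ⟨q, hq, hB.engulf _ _ _ _ (not_lt.1 fun hlt => ?_) hne⟩
  have hstep : (2 : ℝ) ^ (q.2 + 1) ≤ 2 ^ p.2 := zpow_le_zpow_right₀ one_le_two hlt
  rw [zpow_add_one₀ two_ne_zero] at hstep
  linarith [zpow_pos (two_pos : (0 : ℝ) < 2) q.2]

end IsBallSystem

namespace IsDoublingBallSystem

theorem measure_add_six_le (hB : IsDoublingBallSystem μ B D) {x z : X} {k : ℤ}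
    (hx : x ∈ B z k) : μ (B x (k + 3 + 3)) ≤ D ^ 3 * μ (B z k) := calc
  μ (B x (k + 3 + 3)) ≤ D * (D * μ (B x k)) :=
    (hB.measure_add_three_le x _).trans (mul_le_mul_right (hB.measure_add_three_le x k) D)
  _ ≤ D * (D * (D * μ (B z k))) := by
    gcongr
    exact (measure_mono (hB.subset_add_three_of_mem hx)).trans (hB.measure_add_three_le z k)
  _ = D ^ 3 * μ (B z k) := by ring

theorem setLIntegral_add_three_le (hB : IsDoublingBallSystem μ B D) {x z : X} {k : ℤ}
    (hx : x ∈ B z k) :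
    ∫⁻ y in B z (k + 3), w y ∂μ ≤ μ (B z k) * (D ^ 3 * maximalFn μ B w x) := calc
  ∫⁻ y in B z (k + 3), w y ∂μ ≤ ∫⁻ y in B x (k + 3 + 3), w y ∂μ :=
    lintegral_mono_set (hB.add_three_subset_add_six_of_mem hx)
  _ = μ (B x (k + 3 + 3)) * ⨍⁻ y in B x (k + 3 + 3), w y ∂μ :=
    (measure_mul_setLAverage _ (hB.measure_ne_top _ _)).symm
  _ ≤ D ^ 3 * μ (B z k) * maximalFn μ B w x :=
    mul_le_mul' (hB.measure_add_six_le hx) (setLAverage_le_maximalFn _ _)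
  _ = μ (B z k) * (D ^ 3 * maximalFn μ B w x) := by ring

theorem mul_setLIntegral_add_three_le [SFinite μ] (hB : IsDoublingBallSystem μ B D)
    (hf : Measurable f) (hw : Measurable w) {z : X} {k : ℤ} {l : ℝ≥0∞}
    (h : l < ⨍⁻ y in B z k, f y ∂μ) :
    l * ∫⁻ y in B z (k + 3), w y ∂μ ≤
      D ^ 3 * ∫⁻ x in B z k, f x * maximalFn μ B w x ∂μ := by
  have h0 := measure_ne_zero_of_lt_setLAverage h
  have ht := hB.measure_ne_top z k
  rw [← ENNReal.mul_le_mul_iff_right h0 ht]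
  calc μ (B z k) * (l * ∫⁻ y in B z (k + 3), w y ∂μ)
      ≤ μ (B z k) * ((⨍⁻ y in B z k, f y ∂μ) * ∫⁻ y in B z (k + 3), w y ∂μ) := by gcongr
    _ = ∫⁻ x in B z k, f x * ∫⁻ y in B z (k + 3), w y ∂μ ∂μ := by
      rw [← mul_assoc, measure_mul_setLAverage _ ht, lintegral_mul_const _ hf]
    _ ≤ ∫⁻ x in B z k, μ (B z k) * D ^ 3 * (f x * maximalFn μ B w x) ∂μ := by
      refine setLIntegral_mono' (hB.measurableSet z k) fun x hx => ?_
      calc f x * ∫⁻ y in B z (k + 3), w y ∂μ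
          ≤ f x * (μ (B z k) * (D ^ 3 * maximalFn μ B w x)) :=
            mul_le_mul_right (hB.setLIntegral_add_three_le hx) _
        _ = _ := by ring
    _ = μ (B z k) * (D ^ 3 * ∫⁻ x in B z k, f x * maximalFn μ B w x ∂μ) := by
      have hfMw : Measurable fun x => f x * maximalFn μ B w x := hf.mul (hB.measurable_maximalFn hw)
      rw [lintegral_const_mul _ hfMw, mul_assoc]

theorem mul_setLIntegral_le_of_le [SFinite μ] (hB : IsDoublingBallSystem μ B D)
    (hf : Measurable f) (hw : Measurable w) (l : ℝ≥0∞) (n : ℤ) :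
    l * ∫⁻ z in {z | ∃ k ≤ n, l < ⨍⁻ y in B z k, f y ∂μ}, w z ∂μ ≤
      D ^ 3 * ∫⁻ z, f z * maximalFn μ B w z ∂μ := by
  obtain ⟨u, huS, hdisj, hcover⟩ := hB.exists_disjoint_subfamily
    {p : X × ℤ | p.2 ≤ n ∧ l < ⨍⁻ y in B p.1 p.2, f y ∂μ} (fun p hp => hp.1)
  have hcount : u.Countable := by
    have hpos : {p : u | 0 < μ (B p.1.1 p.1.2)} = Set.univ := Set.eq_univ_of_forall fun p =>
      pos_iff_ne_zero.2 (measure_ne_zero_of_lt_setLAverage (huS p.2).2)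
    rw [← Set.countable_coe_iff, ← Set.countable_univ_iff, ← hpos]
    exact Measure.countable_meas_pos_of_disjoint_iUnion (fun p => hB.measurableSet _ _)
      (fun p q hpq => hdisj p.2 q.2 (Subtype.coe_ne_coe.2 hpq))
  have hsub : {z | ∃ k ≤ n, l < ⨍⁻ y in B z k, f y ∂μ} ⊆ ⋃ p : u, B p.1.1 (p.1.2 + 3) := by
    rintro z ⟨k, hk, hz⟩
    obtain ⟨p, hp, hzp⟩ := hcover (z, k) ⟨hk, hz⟩
    exact Set.mem_iUnion.2 ⟨⟨p, hp⟩, hzp (hB.mem z k)⟩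
  have := hcount.to_subtype
  calc l * ∫⁻ z in {z | ∃ k ≤ n, l < ⨍⁻ y in B z k, f y ∂μ}, w z ∂μ
      ≤ l * ∑' p : u, ∫⁻ z in B p.1.1 (p.1.2 + 3), w z ∂μ := by
        gcongr
        exact (lintegral_mono_set hsub).trans (lintegral_iUnion_le _ _)
    _ ≤ ∑' p : u, D ^ 3 * ∫⁻ z in B p.1.1 p.1.2, f z * maximalFn μ B w z ∂μ := by
        rw [← ENNReal.tsum_mul_left]
        exact ENNReal.tsum_le_tsum fun p => hB.mul_setLIntegral_add_three_le hf hw (huS p.2).2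
    _ = D ^ 3 * ∫⁻ z in ⋃ p ∈ u, B p.1 p.2, f z * maximalFn μ B w z ∂μ := by
        rw [ENNReal.tsum_mul_left,
          lintegral_biUnion hcount (fun p _ => hB.measurableSet _ _) hdisj]
    _ ≤ D ^ 3 * ∫⁻ z, f z * maximalFn μ B w z ∂μ := by
        gcongr
        exact Measure.restrict_le_self

theorem mul_setLIntegral_lt_maximalFn_le [SFinite μ] (hB : IsDoublingBallSystem μ B D)
    (hf : Measurable f) (hw : Measurable w) (l : ℝ≥0∞) :
    l * ∫⁻ z in {z | l < maximalFn μ B f z}, w z ∂μ ≤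
      D ^ 3 * ∫⁻ z, f z * maximalFn μ B w z ∂μ := by
  let E : ℕ → Set X := fun n => {z | ∃ k ≤ (n : ℤ), l < ⨍⁻ y in B z k, f y ∂μ}
  have hE : Monotone E := fun m n hmn z ⟨k, hk, hz⟩ => ⟨k, hk.trans (by exact_mod_cast hmn), hz⟩
  have hunion : {z | l < maximalFn μ B f z} = ⋃ n, E n := by
    ext z
    simp only [E, maximalFn, Set.mem_ofPred_eq, lt_iSup_iff, Set.mem_iUnion]
    exact ⟨fun ⟨k, hk⟩ => ⟨k.toNat, k, Int.self_le_toNat k, hk⟩, fun ⟨_, k, _, hk⟩ => ⟨k, hk⟩⟩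
  rw [hunion, setLIntegral_iUnion_of_directed _ hE.directed_le, ENNReal.mul_iSup]
  exact iSup_le fun n => hB.mul_setLIntegral_le_of_le hf hw l n

theorem mul_setLIntegral_lt_maximalFn_div_two_le [SFinite μ] (hB : IsDoublingBallSystem μ B D)
    (hf : Measurable f) (hw : Measurable w) {l : ℝ≥0∞} (hl : l ≠ ⊤) :
    l * ∫⁻ z in {z | l < maximalFn μ B f z / 2}, w z ∂μ ≤
      D ^ 3 * ∫⁻ z in {z | l < f z}, f z * maximalFn μ B w z ∂μ := by
  have hlevel : MeasurableSet {z | l < f z} := measurableSet_lt measurable_const hf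
  have hsplit : ∀ z, f z ≤ {z | l < f z}.indicator f z + l := fun z => by
    by_cases hz : l < f z
    · rw [Set.indicator_of_mem (by exact hz)]
      exact le_self_add
    · rw [Set.indicator_of_notMem (by exact hz), zero_add]
      exact not_lt.1 hz
  have hsub : {z | l < maximalFn μ B f z / 2} ⊆
      {z | l < maximalFn μ B ({z | l < f z}.indicator f) z} := fun z hz => by
    rw [Set.mem_ofPred_eq, ENNReal.lt_div_iff_mul_lt (by simp) (by simp), mul_two] at hz
    exact (ENNReal.add_lt_add_iff_right hl).1 (hz.trans_le (maximalFn_le_add_of_le_add hsplit z))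
  calc l * ∫⁻ z in {z | l < maximalFn μ B f z / 2}, w z ∂μ
      ≤ l * ∫⁻ z in {z | l < maximalFn μ B ({z | l < f z}.indicator f) z}, w z ∂μ :=
        mul_le_mul_right (lintegral_mono_set hsub) l
    _ ≤ D ^ 3 * ∫⁻ z, {z | l < f z}.indicator f z * maximalFn μ B w z ∂μ :=
        hB.mul_setLIntegral_lt_maximalFn_le (hf.indicator hlevel) hw l
    _ = D ^ 3 * ∫⁻ z in {z | l < f z}, f z * maximalFn μ B w z ∂μ := by
        simp_rw [← Set.indicator_mul_left]
        rw [lintegral_indicator hlevel]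

end IsDoublingBallSystem

/-- The constant of the strong type `(p, p)` inequality for the maximal function of a doubling
ball system with constant `D`. -/
def maximalConst (p : ℝ) (D : ℝ≥0∞) : ℝ≥0∞ := 2 ^ p * (ENNReal.ofReal (p / (p - 1)) * D ^ 3)

theorem maximalConst_ne_top {p : ℝ} (hp : 0 ≤ p) (hD : D ≠ ⊤) : maximalConst p D ≠ ⊤ :=
  ENNReal.mul_ne_top (ENNReal.rpow_ne_top_of_nonneg hp (by simp))
    (ENNReal.mul_ne_top ENNReal.ofReal_ne_top (ENNReal.pow_ne_top hD))

namespace IsDoublingBallSystem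

theorem lintegral_maximalFn_rpow_mul_le [SFinite μ] (hB : IsDoublingBallSystem μ B D)
    (hf : Measurable f) (hw : Measurable w) {p : ℝ} (hp : 1 < p) :
    ∫⁻ z, maximalFn μ B f z ^ p * w z ∂μ ≤ maximalConst p D *
      ∫⁻ z, f z ^ p * maximalFn μ B w z ∂μ := by
  have hMf : Measurable fun z => maximalFn μ B f z / 2 := (hB.measurable_maximalFn hf).div_const 2
  have hfMw : Measurable fun z => f z * maximalFn μ B w z := hf.mul (hB.measurable_maximalFn hw)
  have hweak := lintegral_rpow_le_of_mul_measure_lt_le hMf hf hp (ν := μ.withDensity w)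
    (μ := μ.withDensity fun z => f z * maximalFn μ B w z) (C := D ^ 3) fun l _ => by
      rw [withDensity_apply _ (measurableSet_lt measurable_const hMf),
        withDensity_apply _ (measurableSet_lt measurable_const hf)]
      exact hB.mul_setLIntegral_lt_maximalFn_div_two_le hf hw ENNReal.ofReal_ne_top
  calc ∫⁻ z, maximalFn μ B f z ^ p * w z ∂μ
      = 2 ^ p * ∫⁻ z, (maximalFn μ B f z / 2) ^ p ∂μ.withDensity w := by
        rw [lintegral_withDensity_eq_lintegral_mul₀ hw.aemeasurable (hMf.pow_const p).aemeasurable,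
          ← lintegral_const_mul _ (hw.mul (hMf.pow_const p))]
        refine lintegral_congr fun z => ?_
        rw [Pi.mul_apply, mul_left_comm, ← ENNReal.mul_rpow_of_nonneg _ _ (by linarith),
          ENNReal.mul_div_cancel (by simp) (by simp), mul_comm]
    _ ≤ 2 ^ p * (ENNReal.ofReal (p / (p - 1)) * D ^ 3 * ∫⁻ z, f z ^ (p - 1)
          ∂μ.withDensity fun z => f z * maximalFn μ B w z) := mul_le_mul_right hweak _
    _ = maximalConst p D * ∫⁻ z, f z ^ p * maximalFn μ B w z ∂μ := by
        rw [lintegral_withDensity_eq_lintegral_mul _ hfMw (hf.pow_const _), ← mul_assoc,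
          maximalConst]
        congr 1
        refine lintegral_congr fun z => ?_
        rw [Pi.mul_apply, mul_right_comm, mul_comm (f z), ← rpow_eq_rpow_sub_one_mul _ hp.le]

theorem lintegral_maximalFn_rpow_le [SFinite μ] (hB : IsDoublingBallSystem μ B D)
    (hf : Measurable f) {p : ℝ} (hp : 1 < p) :
    ∫⁻ z, maximalFn μ B f z ^ p ∂μ ≤ maximalConst p D * ∫⁻ z, f z ^ p ∂μ := calc
  ∫⁻ z, maximalFn μ B f z ^ p ∂μ = ∫⁻ z, maximalFn μ B f z ^ p * 1 ∂μ := by simp only [mul_one]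
  _ ≤ _ := hB.lintegral_maximalFn_rpow_mul_le hf measurable_const hp
  _ ≤ maximalConst p D * ∫⁻ z, f z ^ p ∂μ := by
    gcongr with z
    exact mul_le_of_le_one_right' (maximalFn_const_le 1 z)

end IsDoublingBallSystem

end Maximal

section MixedMaximal

theorem setLAverage_rpow_mul_rpow_le {X : Type*} [MeasurableSpace X] {μ : Measure X}
    {f g : X → ℝ≥0∞} (hf : Measurable f) (hg : Measurable g) {a : ℝ} (ha0 : 0 ≤ a) (ha1 : a ≤ 1)
    (s : Set X) :
    ⨍⁻ z in s, f z ^ a * g z ^ (1 - a) ∂μ ≤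
      (⨍⁻ z in s, f z ∂μ) ^ a * (⨍⁻ z in s, g z ∂μ) ^ (1 - a) :=
  ENNReal.lintegral_mul_norm_pow_le hf.aemeasurable hg.aemeasurable ha0 (sub_nonneg.2 ha1)
    (add_sub_cancel a 1)

theorem maximalFn_le_rpow_mul_rpow {X : Type*} [MeasurableSpace X] {μ : Measure X}
    {B : X → ℤ → Set X} {f g h : X → ℝ≥0∞} (hf : Measurable f) (hg : Measurable g) {a : ℝ}
    (ha0 : 0 ≤ a) (ha1 : a ≤ 1) (hfg : ∀ᵐ z ∂μ, h z ≤ f z ^ a * g z ^ (1 - a)) (z : X) :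
    maximalFn μ B h z ≤ maximalFn μ B f z ^ a * maximalFn μ B g z ^ (1 - a) := by
  refine iSup_le fun k => ?_
  calc ⨍⁻ w in B z k, h w ∂μ ≤ ⨍⁻ w in B z k, f w ^ a * g w ^ (1 - a) ∂μ := by
        rw [setLAverage_eq, setLAverage_eq]
        gcongr ?_ / _
        exact lintegral_mono_ae (ae_restrict_of_ae hfg)
    _ ≤ (⨍⁻ w in B z k, f w ∂μ) ^ a * (⨍⁻ w in B z k, g w ∂μ) ^ (1 - a) :=
        setLAverage_rpow_mul_rpow_le hf hg ha0 ha1 _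
    _ ≤ maximalFn μ B f z ^ a * maximalFn μ B g z ^ (1 - a) :=
        mul_le_mul' (ENNReal.rpow_le_rpow (setLAverage_le_maximalFn z k) ha0)
          (ENNReal.rpow_le_rpow (setLAverage_le_maximalFn z k) (sub_nonneg.2 ha1))

theorem lintegral_rpow_le_of_forall_lintegral_mul_le {X : Type*} [MeasurableSpace X]
    {μ : Measure X} [SigmaFinite μ] {G : X → ℝ≥0∞} {a b : ℝ} (hab : a.HolderConjugate b)
    {A : ℝ≥0∞} (h : ∀ φ : X → ℝ≥0∞, Measurable φ →
      ∫⁻ t, G t * φ t ∂μ ≤ A * (∫⁻ t, φ t ^ b ∂μ) ^ (1 / b)) :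
    ∫⁻ t, G t ^ a ∂μ ≤ A ^ a := by
  refine le_of_forall_lt_imp_le_of_dense fun c hc => ?_
  obtain ⟨φ, hφG, hcφ⟩ : ∃ φ : SimpleFunc X ℝ≥0, (∀ t, (φ t : ℝ≥0∞) ≤ G t ^ a) ∧
      c < ∫⁻ t, φ t ∂μ := by
    simp only [lintegral_eq_nnreal, lt_iSup_iff] at hc
    obtain ⟨φ, hφ, hcφ⟩ := hc
    refine ⟨φ, hφ, ?_⟩
    rwa [← SimpleFunc.lintegral_eq_lintegral] at hcφ
  obtain ⟨g, hgφ, hgfin, hcg⟩ := exists_lt_lintegral_simpleFunc_of_lt_lintegral hcφ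
  set I := ∫⁻ t, (g t : ℝ≥0∞) ∂μ
  have hgm : Measurable fun t => (g t : ℝ≥0∞) := measurable_coe_nnreal_ennreal.comp g.measurable
  have hsum : 1 / a + 1 / b = 1 := by simpa using hab.one_div_add_one_div
  have hbound : I ^ (1 / a) ≤ A := by
    have hI0 : I ≠ 0 := (zero_le.trans_lt hcg).ne'
    refine (ENNReal.mul_le_mul_iff_left (c := I ^ (1 / b)) (by simp [hI0, hgfin.ne])
      (ENNReal.rpow_ne_top_of_nonneg hab.symm.one_div_nonneg hgfin.ne)).1 ?_
    calc I ^ (1 / a) * I ^ (1 / b) = I := by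
          rw [← ENNReal.rpow_add _ _ hI0 hgfin.ne, hsum, ENNReal.rpow_one]
      _ ≤ ∫⁻ t, G t * (g t : ℝ≥0∞) ^ (1 / b) ∂μ := by
          refine lintegral_mono fun t => ?_
          calc (g t : ℝ≥0∞) = (g t : ℝ≥0∞) ^ (1 / a) * (g t : ℝ≥0∞) ^ (1 / b) := by
                rw [← ENNReal.rpow_add_of_nonneg _ _ hab.one_div_nonneg hab.symm.one_div_nonneg,
                  hsum, ENNReal.rpow_one]
            _ ≤ G t * (g t : ℝ≥0∞) ^ (1 / b) := by
                gcongr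
                rw [one_div, ENNReal.rpow_inv_le_iff hab.pos]
                exact (ENNReal.coe_le_coe.2 (hgφ t)).trans (hφG t)
      _ ≤ A * I ^ (1 / b) := by
          refine (h _ (hgm.pow_const _)).trans_eq ?_
          simp only [← ENNReal.rpow_mul, one_div_mul_cancel hab.symm.ne_zero, ENNReal.rpow_one, I]
  calc c ≤ I := hcg.le
    _ = (I ^ (1 / a)) ^ a := by
        rw [← ENNReal.rpow_mul, one_div_mul_cancel hab.ne_zero, ENNReal.rpow_one]
    _ ≤ A ^ a := ENNReal.rpow_le_rpow hbound hab.nonneg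

variable {X Y : Type*} [MeasureSpace X] [MeasureSpace Y] {B : X → ℤ → Set X} {B' : Y → ℤ → Set Y}
  {D D' : ℝ≥0∞}

/-- The products of the balls of two ball systems with the same index. -/
def prodBall (B : X → ℤ → Set X) (B' : Y → ℤ → Set Y) (z : X × Y) (k : ℤ) : Set (X × Y) :=
  B z.1 k ×ˢ B' z.2 k

theorem IsBallSystem.prod (hB : IsBallSystem B) (hB' : IsBallSystem B') :
    IsBallSystem (prodBall B B') where
  mem z k := ⟨hB.mem _ k, hB'.mem _ k⟩
  engulf z w k l hkl := fun ⟨y, ⟨hz, hz'⟩, hw, hw'⟩ =>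
    Set.prod_mono (hB.engulf _ _ _ _ hkl ⟨y.1, hz, hw⟩) (hB'.engulf _ _ _ _ hkl ⟨y.2, hz', hw'⟩)
  measurableSet_setOf_mem k := by
    have hfst : Measurable fun p : (X × Y) × X × Y => (p.1.1, p.2.1) := by fun_prop
    have hsnd : Measurable fun p : (X × Y) × X × Y => (p.1.2, p.2.2) := by fun_prop
    exact (hfst (hB.measurableSet_setOf_mem k)).inter (hsnd (hB'.measurableSet_setOf_mem k))

theorem IsDoublingBallSystem.prod [SFinite (volume : Measure Y)]
    (hB : IsDoublingBallSystem volume B D) (hB' : IsDoublingBallSystem volume B' D') :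
    IsDoublingBallSystem volume (prodBall B B') (D * D') where
  __ := hB.toIsBallSystem.prod hB'.toIsBallSystem
  measure_ne_top z k := by
    rw [prodBall, Measure.volume_eq_prod, Measure.prod_prod]
    exact ENNReal.mul_ne_top (hB.measure_ne_top _ k) (hB'.measure_ne_top _ k)
  measure_add_three_le z k := by
    rw [prodBall, prodBall, Measure.volume_eq_prod, Measure.prod_prod, Measure.prod_prod,
      mul_mul_mul_comm]
    exact mul_le_mul' (hB.measure_add_three_le _ k) (hB'.measure_add_three_le _ k)

theorem setLIntegral_prod_comp_fst [SFinite (volume : Measure X)] [SFinite (volume : Measure Y)]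
    {φ : X → ℝ≥0∞} (hφ : Measurable φ) (s : Set X) (t : Set Y) :
    ∫⁻ z in s ×ˢ t, φ z.1 = (∫⁻ x in s, φ x) * volume t := by
  rw [Measure.volume_eq_prod,
    setLIntegral_prod (fun z : X × Y => φ z.1) (hφ.comp measurable_fst).aemeasurable]
  simp_rw [setLIntegral_const]
  exact lintegral_mul_const _ hφ

theorem maximalFn_comp_fst_le [SFinite (volume : Measure X)] [SFinite (volume : Measure Y)]
    (hB' : IsDoublingBallSystem volume B' D')
    {φ : X → ℝ≥0∞} (hφ : Measurable φ) (z : X × Y) :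
    maximalFn volume (prodBall B B') (fun z => φ z.1) z ≤ maximalFn volume B φ z.1 := by
  refine iSup_le fun k => le_trans ?_ (setLAverage_le_maximalFn z.1 k)
  rw [setLAverage_eq, setLAverage_eq, prodBall, setLIntegral_prod_comp_fst hφ,
    Measure.volume_eq_prod, Measure.prod_prod]
  rcases eq_or_ne (volume (B' z.2 k)) 0 with h0 | h0
  · simp only [h0, mul_zero, ENNReal.zero_div, zero_le]
  · rw [ENNReal.mul_div_mul_right _ _ h0 (hB'.measure_ne_top _ k)]

theorem measurable_lintegral_rpow [SFinite (volume : Measure Y)] {f : X × Y → ℝ≥0∞}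
    (hf : Measurable f) (p : ℝ) : Measurable fun t => ∫⁻ x, f (t, x) ^ p :=
  (hf.pow_const p).lintegral_prod_right'

theorem lintegral_volume_prod [SFinite (volume : Measure Y)] {f : X × Y → ℝ≥0∞}
    (hf : Measurable f) : ∫⁻ z, f z = ∫⁻ t, ∫⁻ x, f (t, x) :=
  lintegral_prod f hf.aemeasurable

theorem lintegral_mul_comp_fst [SFinite (volume : Measure Y)] {f : X × Y → ℝ≥0∞}
    (hf : Measurable f) {φ : X → ℝ≥0∞} (hφ : Measurable φ) :
    ∫⁻ z, f z * φ z.1 = ∫⁻ t, (∫⁻ x, f (t, x)) * φ t := by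
  rw [lintegral_volume_prod (f := fun z : X × Y => f z * φ z.1) (hf.mul (hφ.comp measurable_fst))]
  exact lintegral_congr fun t => lintegral_mul_const (φ t) (hf.comp measurable_prodMk_left)

theorem lintegral_mul_le_of_maximalFn [SFinite (volume : Measure X)]
    [SFinite (volume : Measure Y)] (hB : IsDoublingBallSystem volume B D)
    (hB' : IsDoublingBallSystem volume B' D') {p : ℝ} (hp : 1 < p) {f : X × Y → ℝ≥0∞}
    (hf : Measurable f) {φ : X → ℝ≥0∞} (hφ : Measurable φ) :
    ∫⁻ t, (∫⁻ x, maximalFn volume (prodBall B B') f (t, x) ^ p) * φ t ≤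
      maximalConst p (D * D') * ∫⁻ t, (∫⁻ x, f (t, x) ^ p) * maximalFn volume B φ t := by
  have hprod := hB.prod hB'
  rw [← lintegral_mul_comp_fst ((hprod.measurable_maximalFn hf).pow_const p) hφ,
    ← lintegral_mul_comp_fst (hf.pow_const p) (hB.measurable_maximalFn hφ)]
  refine (hprod.lintegral_maximalFn_rpow_mul_le hf (hφ.comp measurable_fst) hp).trans ?_
  gcongr with z
  exact maximalFn_comp_fst_le hB' hφ z

theorem lintegral_mixed_maximalFn_le_of_lt [SigmaFinite (volume : Measure X)]
    [SFinite (volume : Measure Y)] (hB : IsDoublingBallSystem volume B D)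
    (hB' : IsDoublingBallSystem volume B' D') {p q : ℝ} (hp : 1 < p) (hpq : p < q)
    {f : X × Y → ℝ≥0∞} (hf : Measurable f) :
    ∫⁻ t, (∫⁻ x, maximalFn volume (prodBall B B') f (t, x) ^ p) ^ (q / p) ≤
      (maximalConst p (D * D') * maximalConst (q / (q - p)) D ^ ((q - p) / q)) ^ (q / p) *
        ∫⁻ t, (∫⁻ x, f (t, x) ^ p) ^ (q / p) := by
  have hp0 : 0 < p := by linarith
  have hq0 : 0 < q := by linarith
  have : 0 < q - p := by linarith
  have hexp : (q / p).HolderConjugate (q / (q - p)) := by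
    rw [Real.holderConjugate_iff, inv_div, inv_div, one_lt_div hp0]
    refine ⟨hpq, ?_⟩
    rw [← add_div, add_sub_cancel, div_self (by linarith)]
  have hdual : 1 < q / (q - p) := hexp.symm.lt
  set H : X → ℝ≥0∞ := fun t => ∫⁻ x, f (t, x) ^ p
  have hH : Measurable H := measurable_lintegral_rpow hf p
  refine (lintegral_rpow_le_of_forall_lintegral_mul_le hexp (A := maximalConst p (D * D') *
    maximalConst (q / (q - p)) D ^ ((q - p) / q) * (∫⁻ t, H t ^ (q / p)) ^ (p / q))
    fun φ hφ => ?_).trans_eq ?_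
  · have hMφ := hB.measurable_maximalFn (μ := volume) hφ
    calc ∫⁻ t, (∫⁻ x, maximalFn volume (prodBall B B') f (t, x) ^ p) * φ t
        ≤ maximalConst p (D * D') * ∫⁻ t, H t * maximalFn volume B φ t :=
          lintegral_mul_le_of_maximalFn hB hB' hp hf hφ
      _ ≤ maximalConst p (D * D') * ((∫⁻ t, H t ^ (q / p)) ^ (p / q) *
            (∫⁻ t, maximalFn volume B φ t ^ (q / (q - p))) ^ ((q - p) / q)) := by
          gcongr
          refine (ENNReal.lintegral_mul_le_Lp_mul_Lq volume hexp hH.aemeasurable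
            hMφ.aemeasurable).trans_eq ?_
          rw [one_div_div, one_div_div]
      _ ≤ maximalConst p (D * D') * ((∫⁻ t, H t ^ (q / p)) ^ (p / q) *
            (maximalConst (q / (q - p)) D * ∫⁻ t, φ t ^ (q / (q - p))) ^ ((q - p) / q)) := by
          gcongr
          exact hB.lintegral_maximalFn_rpow_le hφ hdual
      _ = _ := by
          rw [ENNReal.mul_rpow_of_nonneg _ _ (by positivity), one_div_div]
          ring
  · rw [ENNReal.mul_rpow_of_nonneg _ _ hexp.nonneg, ← ENNReal.rpow_mul,
      div_mul_div_cancel₀ (by linarith), div_self hp0.ne', ENNReal.rpow_one]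

theorem ae_le_rpow_mul_rpow_lintegral {X : Type*} [MeasurableSpace X] {μ : Measure X}
    {h : X → ℝ≥0∞} (hh : Measurable h) {p q : ℝ} (hp : 0 < p) (hq : 0 < q)
    (hfin : ∫⁻ x, h x ^ p ∂μ ≠ ⊤) :
    ∀ᵐ x ∂μ, h x ≤ (h x ^ (p / q) * ((∫⁻ x, h x ^ p ∂μ) ^ (1 / p)) ^ (1 - p / q)) ^ (q / p) *
      ((∫⁻ x, h x ^ p ∂μ) ^ (1 / p)) ^ (1 - q / p) := by
  rcases eq_or_ne (∫⁻ x, h x ^ p ∂μ) 0 with h0 | h0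
  · filter_upwards [(lintegral_eq_zero_iff (hh.pow_const p)).1 h0] with x hx
    simp [(ENNReal.rpow_eq_zero_iff_of_pos hp).1 hx]
  · refine Filter.Eventually.of_forall fun x => le_of_eq ?_
    have hF0 : (∫⁻ x, h x ^ p ∂μ) ^ (1 / p) ≠ 0 := by simp [h0, hfin]
    have hFtop : (∫⁻ x, h x ^ p ∂μ) ^ (1 / p) ≠ ⊤ :=
      ENNReal.rpow_ne_top_of_nonneg (by positivity) hfin
    have hexp : (1 - p / q) * (q / p) + (1 - q / p) = 0 := by field_simp; ring
    rw [ENNReal.mul_rpow_of_nonneg _ _ (by positivity), ← ENNReal.rpow_mul,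
      ← ENNReal.rpow_mul _ _ (q / p), mul_assoc, ← ENNReal.rpow_add _ _ hF0 hFtop, hexp,
      ENNReal.rpow_zero, mul_one, div_mul_div_cancel₀ hq.ne', div_self hp.ne', ENNReal.rpow_one]

theorem lintegral_rpow_mul_rpow_le {X : Type*} [MeasurableSpace X] {μ : Measure X}
    {h : X → ℝ≥0∞} (hh : Measurable h) {p q : ℝ} (hp : 0 < p) (hq : 0 < q) :
    ∫⁻ x, (h x ^ (p / q) * ((∫⁻ x, h x ^ p ∂μ) ^ (1 / p)) ^ (1 - p / q)) ^ q ∂μ ≤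
      (∫⁻ x, h x ^ p ∂μ) ^ (q / p) := by
  have hexp : 1 / p * (1 - p / q) * q = q / p - 1 := by field_simp
  simp_rw [ENNReal.mul_rpow_of_nonneg _ _ hq.le, ← ENNReal.rpow_mul, div_mul_cancel₀ p hq.ne',
    hexp]
  rw [lintegral_mul_const _ (hh.pow_const p)]
  generalize ∫⁻ x, h x ^ p ∂μ = H
  rcases eq_or_ne H 0 with rfl | h0
  · simp
  rcases eq_or_ne H ⊤ with rfl | ht
  · simp [ENNReal.top_rpow_of_pos (div_pos hq hp)]
  · nth_rw 1 [← ENNReal.rpow_one H]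
    rw [← ENNReal.rpow_add _ _ h0 ht, add_sub_cancel]

theorem exists_le_rpow_mul_rpow_lintegral [SFinite (volume : Measure X)]
    [SFinite (volume : Measure Y)] {p q : ℝ} (hp : 0 < p) (hq : 0 < q) {f : X × Y → ℝ≥0∞}
    (hf : Measurable f) (hfin : ∫⁻ t, (∫⁻ x, f (t, x) ^ p) ^ (q / p) ≠ ⊤) :
    ∃ k : X × Y → ℝ≥0∞, Measurable k ∧
      (∀ᵐ z : X × Y, f z ≤
        k z ^ (q / p) * ((∫⁻ x, f (z.1, x) ^ p) ^ (1 / p)) ^ (1 - q / p)) ∧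
      ∀ t, ∫⁻ x, k (t, x) ^ q ≤ (∫⁻ x, f (t, x) ^ p) ^ (q / p) := by
  have hH : Measurable fun t => ∫⁻ x, f (t, x) ^ p := measurable_lintegral_rpow hf p
  have hFfst (s : ℝ) : Measurable fun z : X × Y => ((∫⁻ x, f (z.1, x) ^ p) ^ (1 / p)) ^ s :=
    ((hH.pow_const _).pow_const s).comp measurable_fst
  have hk : Measurable fun z : X × Y =>
      f z ^ (p / q) * ((∫⁻ x, f (z.1, x) ^ p) ^ (1 / p)) ^ (1 - p / q) :=
    (hf.pow_const _).mul (hFfst _)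
  have hslice (t : X) : Measurable fun x => f (t, x) := hf.comp measurable_prodMk_left
  refine ⟨_, hk, ?_, fun t => lintegral_rpow_mul_rpow_le (hslice t) hp hq⟩
  have hset := measurableSet_le hf ((hk.pow_const (q / p)).mul (hFfst (1 - q / p)))
  refine (Measure.ae_prod_iff_ae_ae (p := fun z : X × Y => _) hset).2 ?_
  filter_upwards [ae_lt_top (hH.pow_const _) hfin] with t ht
  exact ae_le_rpow_mul_rpow_lintegral (hslice t) hp hq
    ((ENNReal.rpow_lt_top_iff_of_pos (div_pos hq hp)).1 ht).ne

theorem lintegral_maximalFn_rpow_le_of_ae_le [SFinite (volume : Measure X)]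
    [SFinite (volume : Measure Y)] (hB : IsBallSystem B)
    (hB' : IsDoublingBallSystem volume B' D') {p q : ℝ} (hq : 0 < q) (hqp : q ≤ p)
    {f k : X × Y → ℝ≥0∞} {F : X → ℝ≥0∞} (hk : Measurable k) (hF : Measurable F)
    (hfk : ∀ᵐ z : X × Y, f z ≤ k z ^ (q / p) * F z.1 ^ (1 - q / p)) (t : X) :
    (∫⁻ x, maximalFn volume (prodBall B B') f (t, x) ^ p) ^ (q / p) ≤
      (∫⁻ x, maximalFn volume (prodBall B B') k (t, x) ^ q) ^ (q / p) *
        (maximalFn volume B F t ^ q) ^ (1 - q / p) := by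
  have hp : 0 < p := hq.trans_le hqp
  have ha0 : 0 < q / p := by positivity
  have ha1 : q / p ≤ 1 := (div_le_one hp).2 hqp
  have hMk : Measurable fun x => maximalFn volume (prodBall B B') k (t, x) ^ q :=
    (((hB.prod hB'.toIsBallSystem).measurable_maximalFn hk).comp measurable_prodMk_left).pow_const q
  have hexp : (1 - q / p) * p * (q / p) = q * (1 - q / p) := by field_simp
  rw [← ENNReal.rpow_mul, ← hexp, ENNReal.rpow_mul _ _ (q / p),
    ← ENNReal.mul_rpow_of_nonneg _ _ ha0.le, ← lintegral_mul_const _ hMk]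
  gcongr with x
  calc maximalFn volume (prodBall B B') f (t, x) ^ p
      ≤ (maximalFn volume (prodBall B B') k (t, x) ^ (q / p) *
          maximalFn volume B F t ^ (1 - q / p)) ^ p := by
        gcongr
        refine (maximalFn_le_rpow_mul_rpow hk (hF.comp measurable_fst) ha0.le ha1 hfk _).trans ?_
        gcongr
        exact maximalFn_comp_fst_le hB' hF _
    _ = maximalFn volume (prodBall B B') k (t, x) ^ q *
          maximalFn volume B F t ^ ((1 - q / p) * p) := by
        rw [ENNReal.mul_rpow_of_nonneg _ _ hp.le, ← ENNReal.rpow_mul, ← ENNReal.rpow_mul,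
          div_mul_cancel₀ q hp.ne']

theorem lintegral_mixed_maximalFn_le_of_le [SFinite (volume : Measure X)]
    [SFinite (volume : Measure Y)] (hB : IsDoublingBallSystem volume B D)
    (hB' : IsDoublingBallSystem volume B' D') {p q : ℝ} (hq : 1 < q) (hqp : q ≤ p)
    {f : X × Y → ℝ≥0∞} (hf : Measurable f)
    (hfin : ∫⁻ t, (∫⁻ x, f (t, x) ^ p) ^ (q / p) ≠ ⊤) :
    ∫⁻ t, (∫⁻ x, maximalFn volume (prodBall B B') f (t, x) ^ p) ^ (q / p) ≤
      maximalConst q (D * D') ^ (q / p) * maximalConst q D ^ (1 - q / p) *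
        ∫⁻ t, (∫⁻ x, f (t, x) ^ p) ^ (q / p) := by
  have hq0 : 0 < q := by linarith
  have hp0 : 0 < p := by linarith
  have ha1 : 0 ≤ 1 - q / p := sub_nonneg.2 ((div_le_one hp0).2 hqp)
  have hprod := hB.prod hB'
  obtain ⟨k, hk, hfk, hkle⟩ := exists_le_rpow_mul_rpow_lintegral hp0 hq0 hf hfin
  set F : X → ℝ≥0∞ := fun t => (∫⁻ x, f (t, x) ^ p) ^ (1 / p) with hFdef
  have hF : Measurable F := (measurable_lintegral_rpow hf p).pow_const _
  have hMk := (hprod.measurable_maximalFn (μ := volume) hk).pow_const q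
  set I := ∫⁻ t, (∫⁻ x, f (t, x) ^ p) ^ (q / p)
  have hkI : ∫⁻ z, k z ^ q ≤ I := by
    rw [lintegral_volume_prod (hk.pow_const q)]
    exact lintegral_mono hkle
  have hFI : ∫⁻ t, F t ^ q = I := by
    simp only [hFdef, I, ← ENNReal.rpow_mul, one_div_mul_eq_div]
  calc ∫⁻ t, (∫⁻ x, maximalFn volume (prodBall B B') f (t, x) ^ p) ^ (q / p)
      ≤ ∫⁻ t, (∫⁻ x, maximalFn volume (prodBall B B') k (t, x) ^ q) ^ (q / p) *
          (maximalFn volume B F t ^ q) ^ (1 - q / p) :=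
        lintegral_mono (lintegral_maximalFn_rpow_le_of_ae_le hB.toIsBallSystem hB' hq0 hqp
          hk hF hfk)
    _ ≤ (∫⁻ z, maximalFn volume (prodBall B B') k z ^ q) ^ (q / p) *
          (∫⁻ t, maximalFn volume B F t ^ q) ^ (1 - q / p) := by
        rw [lintegral_volume_prod hMk]
        exact ENNReal.lintegral_mul_norm_pow_le
          (measurable_lintegral_rpow (hprod.measurable_maximalFn hk) q).aemeasurable
          ((hB.measurable_maximalFn hF).pow_const q).aemeasurable (by positivity) ha1
          (add_sub_cancel _ 1)
    _ ≤ (maximalConst q (D * D') * I) ^ (q / p) * (maximalConst q D * I) ^ (1 - q / p) := by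
        gcongr
        · exact (hprod.lintegral_maximalFn_rpow_le hk hq).trans (mul_le_mul_right hkI _)
        · exact (hB.lintegral_maximalFn_rpow_le hF hq).trans_eq (by rw [hFI])
    _ = _ := by
        rw [ENNReal.mul_rpow_of_nonneg _ _ (by positivity), ENNReal.mul_rpow_of_nonneg _ _ ha1,
          mul_mul_mul_comm, ← ENNReal.rpow_add_of_nonneg _ _ (by positivity) ha1, add_sub_cancel,
          ENNReal.rpow_one]

/-- The mixed norm of a nonnegative function on a product, with exponent `p` in the inner and `q`
in the outer variable. -/
def lmixed (p q : ℝ) (f : X × Y → ℝ≥0∞) : ℝ≥0∞ :=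
  (∫⁻ t, (∫⁻ x, f (t, x) ^ p) ^ (q / p)) ^ (1 / q)

theorem exists_lmixed_maximalFn_le [SigmaFinite (volume : Measure X)]
    [SFinite (volume : Measure Y)] (hB : IsDoublingBallSystem volume B D)
    (hB' : IsDoublingBallSystem volume B' D') (hD : D ≠ ⊤) (hD' : D' ≠ ⊤) {p q : ℝ}
    (hp : 1 < p) (hq : 1 < q) :
    ∃ C : ℝ≥0∞, C ≠ ⊤ ∧ ∀ f : X × Y → ℝ≥0∞, Measurable f →
      lmixed p q (maximalFn volume (prodBall B B') f) ≤ C * lmixed p q f := by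
  have hq0 : 0 < q := by linarith
  have hDD : D * D' ≠ ⊤ := ENNReal.mul_ne_top hD hD'
  have hdiv : 0 ≤ q / p := by positivity
  suffices ∃ C : ℝ≥0∞, C ≠ ⊤ ∧ ∀ f : X × Y → ℝ≥0∞, Measurable f →
      ∫⁻ t, (∫⁻ x, f (t, x) ^ p) ^ (q / p) ≠ ⊤ →
      ∫⁻ t, (∫⁻ x, maximalFn volume (prodBall B B') f (t, x) ^ p) ^ (q / p) ≤
        C * ∫⁻ t, (∫⁻ x, f (t, x) ^ p) ^ (q / p) by
    obtain ⟨C, hC, h⟩ := this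
    refine ⟨(C + 1) ^ (1 / q), ENNReal.rpow_ne_top_of_nonneg (by positivity)
      (ENNReal.add_ne_top.2 ⟨hC, ENNReal.one_ne_top⟩), fun f hf => ?_⟩
    rw [lmixed, lmixed, ← ENNReal.mul_rpow_of_nonneg _ _ (by positivity)]
    gcongr
    by_cases hfin : ∫⁻ t, (∫⁻ x, f (t, x) ^ p) ^ (q / p) = ⊤
    · rw [hfin, ENNReal.mul_top (by simp)]
      exact le_top
    · exact (h f hf hfin).trans (mul_le_mul_left le_self_add _)
  rcases le_or_gt q p with hqp | hpq
  · exact ⟨_, ENNReal.mul_ne_top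
      (ENNReal.rpow_ne_top_of_nonneg hdiv (maximalConst_ne_top hq0.le hDD))
      (ENNReal.rpow_ne_top_of_nonneg (sub_nonneg.2 ((div_le_one (by linarith)).2 hqp))
        (maximalConst_ne_top hq0.le hD)),
      fun f hf hfin => lintegral_mixed_maximalFn_le_of_le hB hB' hq hqp hf hfin⟩
  · have : 0 < q - p := by linarith
    exact ⟨_, ENNReal.rpow_ne_top_of_nonneg hdiv (ENNReal.mul_ne_top
      (maximalConst_ne_top (by linarith) hDD) (ENNReal.rpow_ne_top_of_nonneg (by positivity)
        (maximalConst_ne_top (by positivity) hD))),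
      fun f hf _ => lintegral_mixed_maximalFn_le_of_lt hB hB' hp hpq hf⟩

end MixedMaximal

section MetricBalls

variable {b : ℝ}

theorem isBallSystem_ball {E : Type*} [PseudoMetricSpace E] [MeasurableSpace E]
    [OpensMeasurableSpace E] [SecondCountableTopology E] (hb : 2 ≤ b) :
    IsBallSystem fun (z : E) (k : ℤ) => Metric.ball z (b ^ k) where
  mem z k := Metric.mem_ball_self (zpow_pos (by linarith) k)
  engulf z w k l hkl := by
    rintro ⟨y, hyz, hyw⟩ x hx
    rw [Metric.mem_ball] at *
    have hmono : b ^ k ≤ b ^ l := zpow_le_zpow_right₀ (by linarith) hkl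
    have hpos : 0 < b ^ l := zpow_pos (by linarith) l
    calc dist x w ≤ dist x z + (dist y z + dist y w) :=
          (dist_triangle x z w).trans (add_le_add_right (dist_triangle_left z w y) _)
      _ < b ^ l * 2 ^ 3 := by linarith
      _ ≤ b ^ l * b ^ 3 := by gcongr
      _ = b ^ (l + 3) := by rw [zpow_add₀ (by linarith)]; norm_cast
  measurableSet_setOf_mem k := measurableSet_lt (measurable_snd.dist measurable_fst)
    measurable_const

theorem isDoublingBallSystem_ball {E : Type*} [NormedAddCommGroup E] [NormedSpace ℝ E]
    [FiniteDimensional ℝ E] [MeasurableSpace E] [BorelSpace E] (μ : Measure E)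
    [μ.IsAddHaarMeasure] (hb : 2 ≤ b) :
    IsDoublingBallSystem μ (fun (z : E) (k : ℤ) => Metric.ball z (b ^ k))
      (ENNReal.ofReal ((b ^ 3) ^ Module.finrank ℝ E)) where
  __ := have := FiniteDimensional.proper ℝ E; isBallSystem_ball hb
  measure_ne_top z k := measure_ball_ne_top
  measure_add_three_le z k := by
    have hstep : b ^ (k + 3) = b ^ 3 * b ^ k := by
      rw [zpow_add₀ (by linarith), mul_comm]
      norm_cast
    rw [hstep, Measure.addHaar_ball_mul_of_pos μ z (by positivity),
      Measure.addHaar_ball_center μ z]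

end MetricBalls

theorem lintegral_le_rpow_mul_measure_univ {X : Type*} [MeasurableSpace X] {μ : Measure X} {s : ℝ}
    (hs : 1 ≤ s) {h : X → ℝ≥0∞} (hh : Measurable h) :
    ∫⁻ a, h a ∂μ ≤ (∫⁻ a, h a ^ s ∂μ) ^ (1 / s) * μ Set.univ ^ (1 - 1 / s) := by
  have hs0 : 0 < s := by linarith
  have hHolder := ENNReal.lintegral_mul_norm_pow_le (μ := μ) (hh.pow_const s).aemeasurable
    (aemeasurable_const (b := 1)) (p := 1 / s) (q := 1 - 1 / s) (by positivity)
    (sub_nonneg.2 ((div_le_one hs0).2 hs)) (by ring)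
  simpa only [← ENNReal.rpow_mul, mul_one_div_cancel hs0.ne', ENNReal.rpow_one, ENNReal.one_rpow,
    mul_one, lintegral_one] using hHolder

section MixedNorm

variable {X Y : Type*} [MeasureSpace X] [MeasureSpace Y] {p q : ℝ} {f g : X × Y → ℝ≥0∞}

theorem lmixed_mono (hp : 0 ≤ p) (hq : 0 ≤ q) (h : f ≤ g) : lmixed p q f ≤ lmixed p q g := by
  unfold lmixed
  gcongr with t x
  exact h _

theorem lmixed_const_mul [SFinite (volume : Measure Y)] (hp : 0 < p) (hq : 0 < q)
    (hf : Measurable f) (c : ℝ≥0∞) : lmixed p q (fun z => c * f z) = c * lmixed p q f := by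
  have hslice (t : X) : ∫⁻ x, (c * f (t, x)) ^ p = c ^ p * ∫⁻ x, f (t, x) ^ p := by
    simp_rw [ENNReal.mul_rpow_of_nonneg _ _ hp.le]
    exact lintegral_const_mul _ ((hf.comp measurable_prodMk_left).pow_const p)
  unfold lmixed
  simp_rw [hslice, ENNReal.mul_rpow_of_nonneg _ _ (div_pos hq hp).le, ← ENNReal.rpow_mul,
    mul_div_cancel₀ q hp.ne']
  rw [lintegral_const_mul _ ((measurable_lintegral_rpow hf p).pow_const _),
    ENNReal.mul_rpow_of_nonneg _ _ (by positivity), ← ENNReal.rpow_mul,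
    mul_one_div_cancel hq.ne', ENNReal.rpow_one]

theorem lmixed_add_le [SFinite (volume : Measure Y)] (hp : 1 ≤ p) (hq : 1 ≤ q)
    (hf : Measurable f) (hg : Measurable g) :
    lmixed p q (fun z => f z + g z) ≤ lmixed p q f + lmixed p q g := by
  have : 0 < q := by linarith
  have hnested (h : X × Y → ℝ≥0∞) :
      lmixed p q h = (∫⁻ t, ((∫⁻ x, h (t, x) ^ p) ^ (1 / p)) ^ q) ^ (1 / q) := by
    simp only [lmixed, ← ENNReal.rpow_mul, one_div_mul_eq_div]
  simp only [hnested]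
  refine le_trans ?_ (ENNReal.lintegral_Lp_add_le
    ((measurable_lintegral_rpow hf p).pow_const (1 / p)).aemeasurable
    ((measurable_lintegral_rpow hg p).pow_const (1 / p)).aemeasurable hq)
  gcongr with t
  exact ENNReal.lintegral_Lp_add_le (hf.comp measurable_prodMk_left).aemeasurable
    (hg.comp measurable_prodMk_left).aemeasurable hp

theorem lmixed_rpow {κ : ℝ} (hκ : 0 < κ) (hq : q ≠ 0) :
    lmixed p q (fun z => f z ^ κ) = lmixed (κ * p) (κ * q) f ^ κ := by
  have hexp : 1 / (κ * q) * κ = 1 / q := by field_simp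
  simp only [lmixed, ← ENNReal.rpow_mul, mul_div_mul_left _ _ hκ.ne', hexp]

theorem lmixed_indicator_prod (hp : 0 < p) (hq : 0 < q) {s : Set X} {t : Set Y}
    (hs : MeasurableSet s) (ht : MeasurableSet t) :
    lmixed p q ((s ×ˢ t).indicator f) =
      (∫⁻ x in s, (∫⁻ y in t, f (x, y) ^ p) ^ (q / p)) ^ (1 / q) := by
  have hslice (x : X) : (∫⁻ y, (s ×ˢ t).indicator f (x, y) ^ p) ^ (q / p) =
      s.indicator (fun x => (∫⁻ y in t, f (x, y) ^ p) ^ (q / p)) x := by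
    by_cases hx : x ∈ s
    · rw [Set.indicator_of_mem hx, ← lintegral_indicator ht]
      congr 1
      refine lintegral_congr fun y => ?_
      by_cases hy : y ∈ t <;> simp [hx, hy, hp]
    · simp [hx, hp, div_pos hq hp]
  unfold lmixed
  simp_rw [hslice]
  rw [lintegral_indicator hs]

theorem lmixed_indicator_prod_one (hp : 0 < p) (hq : 0 < q) {s : Set X} {t : Set Y}
    (hs : MeasurableSet s) (ht : MeasurableSet t) :
    lmixed p q ((s ×ˢ t).indicator fun _ => 1) = volume t ^ (1 / p) * volume s ^ (1 / q) := by
  have hexp : q / p * (1 / q) = 1 / p := by field_simp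
  simp only [lmixed_indicator_prod hp hq hs ht, ENNReal.one_rpow, setLIntegral_const, one_mul]
  rw [ENNReal.mul_rpow_of_nonneg _ _ (by positivity), ← ENNReal.rpow_mul, hexp]

theorem setLIntegral_prod_le_lmixed [SFinite (volume : Measure X)] [SFinite (volume : Measure Y)]
    (hp : 1 ≤ p) (hq : 1 ≤ q) {s : Set X} {t : Set Y} (hs : MeasurableSet s)
    (ht : MeasurableSet t) (hf : Measurable f) :
    ∫⁻ z in s ×ˢ t, f z ≤ lmixed p q ((s ×ˢ t).indicator f) *
      (volume t ^ (1 - 1 / p) * volume s ^ (1 - 1 / q)) := by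
  have hslice (x : X) : Measurable fun y => f (x, y) := hf.comp measurable_prodMk_left
  have hH : Measurable fun x => (∫⁻ y in t, f (x, y) ^ p) ^ (1 / p) :=
    (hf.pow_const p).lintegral_prod_right'.pow_const _
  rw [lmixed_indicator_prod (by linarith) (by linarith) hs ht]
  calc ∫⁻ z in s ×ˢ t, f z = ∫⁻ x in s, ∫⁻ y in t, f (x, y) := by
        rw [Measure.volume_eq_prod, setLIntegral_prod _ hf.aemeasurable]
    _ ≤ ∫⁻ x in s, (∫⁻ y in t, f (x, y) ^ p) ^ (1 / p) * volume t ^ (1 - 1 / p) := by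
        gcongr with x
        simpa only [Measure.restrict_apply_univ] using
          lintegral_le_rpow_mul_measure_univ (μ := volume.restrict t) hp (hslice x)
    _ = (∫⁻ x in s, (∫⁻ y in t, f (x, y) ^ p) ^ (1 / p)) * volume t ^ (1 - 1 / p) :=
        lintegral_mul_const _ hH
    _ ≤ (∫⁻ x in s, (∫⁻ y in t, f (x, y) ^ p) ^ (q / p)) ^ (1 / q) * volume s ^ (1 - 1 / q) *
          volume t ^ (1 - 1 / p) := by
        gcongr
        simpa only [Measure.restrict_apply_univ, ← ENNReal.rpow_mul, one_div_mul_eq_div] using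
          lintegral_le_rpow_mul_measure_univ (μ := volume.restrict s) hq hH
    _ = _ := by ring

end MixedNorm

section Morrey

variable {d : ℕ} {p q : ℝ} {f : SpaceTime d → ℝ≥0∞}

theorem cylinder_eq_prod (ρ : ℝ≥0) (z : SpaceTime d) :
    cylinder (ρ : ℝ≥0∞) z = Set.Ico z.1 (z.1 + (ρ : ℝ) ^ 2) ×ˢ Metric.ball z.2 ρ := by
  ext w
  rw [mem_cylinder_coe, Set.mem_prod, Set.mem_Ico, Metric.mem_ball, dist_comm w.2, and_comm]

theorem measurableSet_cylinder (R : ℝ≥0∞) (z : SpaceTime d) : MeasurableSet (cylinder R z) := by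
  have hspace : Measurable fun w : SpaceTime d => edist z.2 w.2 := by fun_prop
  have htime : Measurable fun w : SpaceTime d => ENNReal.ofReal (w.1 - z.1) := by fun_prop
  exact (measurableSet_lt hspace measurable_const).inter
    ((measurableSet_le measurable_const measurable_fst).inter
      (measurableSet_lt htime measurable_const))

/-- The volume of the unit ball of `ℝ^d`. -/
def unitVol (d : ℕ) : ℝ≥0∞ := volume (Metric.ball (0 : EuclideanSpace ℝ (Fin d)) 1)

theorem unitVol_ne_zero : unitVol d ≠ 0 := (Metric.measure_ball_pos _ _ one_pos).ne'

theorem unitVol_ne_top : unitVol d ≠ ⊤ := measure_ball_lt_top.ne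

theorem volume_ball_coe (x : EuclideanSpace ℝ (Fin d)) {ρ : ℝ≥0} (hρ : 0 < ρ) :
    volume (Metric.ball x ρ) = (ρ : ℝ≥0∞) ^ (d : ℝ) * unitVol d := by
  rw [Measure.addHaar_ball_of_pos _ _ (by exact_mod_cast hρ), finrank_euclideanSpace_fin,
    ENNReal.ofReal_pow ρ.coe_nonneg, ENNReal.ofReal_coe_nnreal, ENNReal.rpow_natCast, unitVol]

theorem volume_Ico_coe (t : ℝ) (ρ : ℝ≥0) :
    volume (Set.Ico t (t + (ρ : ℝ) ^ 2)) = (ρ : ℝ≥0∞) ^ (2 : ℝ) := by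
  rw [Real.volume_Ico, add_sub_cancel_left, ENNReal.ofReal_pow ρ.coe_nonneg,
    ENNReal.ofReal_coe_nnreal]
  norm_cast

theorem lmixed_indicator_cylinder_one (hp : 0 < p) (hq : 0 < q) {ρ : ℝ≥0} (hρ : 0 < ρ)
    (z : SpaceTime d) :
    lmixed p q ((cylinder (ρ : ℝ≥0∞) z).indicator fun _ => 1) =
      unitVol d ^ (1 / p) * (ρ : ℝ≥0∞) ^ (d / p + 2 / q) := by
  rw [cylinder_eq_prod, lmixed_indicator_prod_one hp hq measurableSet_Ico measurableSet_ball,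
    volume_ball_coe _ hρ, volume_Ico_coe, ENNReal.mul_rpow_of_nonneg _ _ (by positivity),
    ← ENNReal.rpow_mul, ← ENNReal.rpow_mul, mul_comm (_ ^ _) (unitVol d ^ _), mul_assoc,
    ← ENNReal.rpow_add _ _ (by simpa using hρ.ne') ENNReal.coe_ne_top, mul_one_div, mul_one_div]

/-- The mixed-norm parabolic Morrey norm of a function with values in `[0, ∞]`. -/
def lmorrey (p q β : ℝ) (Q : Set (SpaceTime d)) (f : SpaceTime d → ℝ≥0∞) : ℝ≥0∞ :=
  ⨆ (ρ : ℝ≥0) (_ : 0 < ρ) (z : SpaceTime d) (_ : z ∈ Q),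
    (ρ : ℝ≥0∞) ^ β * ((lmixed p q ((cylinder (ρ : ℝ≥0∞) z).indicator fun _ => 1))⁻¹ *
      lmixed p q ((cylinder (ρ : ℝ≥0∞) z).indicator (Q.indicator f)))

theorem morreyNorm_eq_lmorrey {F : Type*} [NormedAddCommGroup F] (p q β : ℝ)
    (Q : Set (SpaceTime d)) (u : SpaceTime d → F) :
    morreyNorm p q β Q u = lmorrey p q β Q fun z => ‖u z‖ₑ := by
  simp only [morreyNorm, mixedNormAvg, mixedNorm, lmorrey, lmixed,
    enorm_indicator_eq_indicator_enorm, enorm_one]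

theorem lmixed_cylinder_one_ne_zero (hp : 0 < p) (hq : 0 < q) {ρ : ℝ≥0} (hρ : 0 < ρ)
    (z : SpaceTime d) : lmixed p q ((cylinder (ρ : ℝ≥0∞) z).indicator fun _ => 1) ≠ 0 := by
  rw [lmixed_indicator_cylinder_one hp hq hρ]
  exact mul_ne_zero (ENNReal.rpow_pos (pos_iff_ne_zero.2 unitVol_ne_zero) unitVol_ne_top).ne'
    (ENNReal.rpow_pos (by simpa using hρ) ENNReal.coe_ne_top).ne'

theorem lmixed_cylinder_one_ne_top (hp : 0 < p) (hq : 0 < q) {ρ : ℝ≥0} (hρ : 0 < ρ)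
    (z : SpaceTime d) : lmixed p q ((cylinder (ρ : ℝ≥0∞) z).indicator fun _ => 1) ≠ ⊤ := by
  rw [lmixed_indicator_cylinder_one hp hq hρ]
  exact ENNReal.mul_ne_top (ENNReal.rpow_ne_top_of_nonneg (by positivity) unitVol_ne_top)
    (ENNReal.rpow_ne_top_of_nonneg (by positivity) ENNReal.coe_ne_top)

theorem lmixed_cylinder_le_lmorrey (hp : 0 < p) (hq : 0 < q) (β : ℝ) {Q : Set (SpaceTime d)}
    {ρ : ℝ≥0} (hρ : 0 < ρ) {z : SpaceTime d} (hz : z ∈ Q) :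
    lmixed p q ((cylinder (ρ : ℝ≥0∞) z).indicator (Q.indicator f)) ≤
      (ρ : ℝ≥0∞) ^ (-β) * lmorrey p q β Q f *
        lmixed p q ((cylinder (ρ : ℝ≥0∞) z).indicator fun _ => 1) := by
  have h0 : (ρ : ℝ≥0∞) ≠ 0 := by simpa using hρ.ne'
  have hN0 := lmixed_cylinder_one_ne_zero hp hq hρ z
  have hNt := lmixed_cylinder_one_ne_top hp hq hρ z
  have hsup : (ρ : ℝ≥0∞) ^ β * ((lmixed p q ((cylinder (ρ : ℝ≥0∞) z).indicator fun _ => 1))⁻¹ *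
      lmixed p q ((cylinder (ρ : ℝ≥0∞) z).indicator (Q.indicator f))) ≤ lmorrey p q β Q f :=
    le_iSup₂_of_le ρ hρ (le_iSup₂_of_le z hz le_rfl)
  set N := lmixed p q ((cylinder (ρ : ℝ≥0∞) z).indicator fun _ => 1)
  set A := lmixed p q ((cylinder (ρ : ℝ≥0∞) z).indicator (Q.indicator f))
  calc A = ((ρ : ℝ≥0∞) ^ (-β) * (ρ : ℝ≥0∞) ^ β) * (N * N⁻¹) * A := by
        rw [← ENNReal.rpow_add _ _ h0 ENNReal.coe_ne_top, ENNReal.mul_inv_cancel hN0 hNt,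
          neg_add_cancel, ENNReal.rpow_zero, one_mul, one_mul]
    _ = (ρ : ℝ≥0∞) ^ (-β) * ((ρ : ℝ≥0∞) ^ β * (N⁻¹ * A)) * N := by ring
    _ ≤ _ := by gcongr

theorem setLIntegral_cylinder_le_lmorrey (hp : 1 ≤ p) (hq : 1 ≤ q) (β : ℝ) {Q : Set (SpaceTime d)}
    (hQ : MeasurableSet Q) (hf : Measurable f) {ρ : ℝ≥0} (hρ : 0 < ρ) {z : SpaceTime d}
    (hz : z ∈ Q) :
    ∫⁻ w in cylinder (ρ : ℝ≥0∞) z, Q.indicator f w ≤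
      (ρ : ℝ≥0∞) ^ (d + 2 - β) * unitVol d * lmorrey p q β Q f := by
  have hp0 : 0 < p := by linarith
  have hq0 : 0 < q := by linarith
  have h0 : (ρ : ℝ≥0∞) ≠ 0 := by simpa using hρ.ne'
  have hp1 : 0 ≤ 1 - 1 / p := sub_nonneg.2 ((div_le_one hp0).2 hp)
  have hunit : unitVol d = unitVol d ^ (1 / p) * unitVol d ^ (1 - 1 / p) := by
    rw [← ENNReal.rpow_add _ _ unitVol_ne_zero unitVol_ne_top, add_sub_cancel, ENNReal.rpow_one]
  have hradius : (ρ : ℝ≥0∞) ^ (d + 2 - β) = (ρ : ℝ≥0∞) ^ (-β) * (ρ : ℝ≥0∞) ^ (d / p + 2 / q) *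
      ((ρ : ℝ≥0∞) ^ (d * (1 - 1 / p)) * (ρ : ℝ≥0∞) ^ (2 * (1 - 1 / q))) := by
    simp only [← ENNReal.rpow_add _ _ h0 ENNReal.coe_ne_top]
    congr 1
    ring
  calc ∫⁻ w in cylinder (ρ : ℝ≥0∞) z, Q.indicator f w
      ≤ lmixed p q ((cylinder (ρ : ℝ≥0∞) z).indicator (Q.indicator f)) *
          (((ρ : ℝ≥0∞) ^ (d : ℝ) * unitVol d) ^ (1 - 1 / p) *
            ((ρ : ℝ≥0∞) ^ (2 : ℝ)) ^ (1 - 1 / q)) := by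
        rw [cylinder_eq_prod, ← volume_ball_coe z.2 hρ, ← volume_Ico_coe z.1]
        exact setLIntegral_prod_le_lmixed hp hq measurableSet_Ico measurableSet_ball
          (hf.indicator hQ)
    _ ≤ (ρ : ℝ≥0∞) ^ (-β) * lmorrey p q β Q f *
          (unitVol d ^ (1 / p) * (ρ : ℝ≥0∞) ^ (d / p + 2 / q)) *
          (((ρ : ℝ≥0∞) ^ (d : ℝ) * unitVol d) ^ (1 - 1 / p) *
            ((ρ : ℝ≥0∞) ^ (2 : ℝ)) ^ (1 - 1 / q)) := by
        rw [← lmixed_indicator_cylinder_one hp0 hq0 hρ z]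
        gcongr
        exact lmixed_cylinder_le_lmorrey hp0 hq0 β hρ hz
    _ = _ := by
        rw [ENNReal.mul_rpow_of_nonneg _ _ hp1, ← ENNReal.rpow_mul, ← ENNReal.rpow_mul, hradius]
        nth_rw 3 [hunit]
        ring

end Morrey

section MorreyOrder

variable {d : ℕ} {p q γ : ℝ} {Q : Set (SpaceTime d)} {f g : SpaceTime d → ℝ≥0∞}

theorem lmorrey_le_of_forall_lmixed_le (hp : 0 < p) (hq : 0 < q) {M : ℝ≥0∞}
    (h : ∀ ρ : ℝ≥0, 0 < ρ → ∀ z ∈ Q,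
      lmixed p q ((cylinder (ρ : ℝ≥0∞) z).indicator (Q.indicator f)) ≤
        M * ((ρ : ℝ≥0∞) ^ (-γ) *
          lmixed p q ((cylinder (ρ : ℝ≥0∞) z).indicator fun _ => 1))) :
    lmorrey p q γ Q f ≤ M := by
  refine iSup₂_le fun ρ hρ => iSup₂_le fun z hz => ?_
  have hρ0 : (ρ : ℝ≥0∞) ≠ 0 := ENNReal.coe_ne_zero.2 hρ.ne'
  have hN0 := lmixed_cylinder_one_ne_zero hp hq hρ z
  have hNt := lmixed_cylinder_one_ne_top hp hq hρ z
  set N := lmixed p q ((cylinder (ρ : ℝ≥0∞) z).indicator fun _ => 1)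
  have hcancel : (ρ : ℝ≥0∞) ^ γ * (ρ : ℝ≥0∞) ^ (-γ) = 1 := by
    rw [← ENNReal.rpow_add _ _ hρ0 ENNReal.coe_ne_top, add_neg_cancel, ENNReal.rpow_zero]
  calc (ρ : ℝ≥0∞) ^ γ * (N⁻¹ *
        lmixed p q ((cylinder (ρ : ℝ≥0∞) z).indicator (Q.indicator f)))
      ≤ (ρ : ℝ≥0∞) ^ γ * (N⁻¹ * (M * ((ρ : ℝ≥0∞) ^ (-γ) * N))) := by
        gcongr
        exact h ρ hρ z hz
    _ = M * ((ρ : ℝ≥0∞) ^ γ * (ρ : ℝ≥0∞) ^ (-γ)) * (N⁻¹ * N) := by ring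
    _ = M := by rw [hcancel, ENNReal.inv_mul_cancel hN0 hNt, mul_one, mul_one]

theorem lmorrey_mono (hp : 0 ≤ p) (hq : 0 ≤ q) (h : ∀ z ∈ Q, f z ≤ g z) :
    lmorrey p q γ Q f ≤ lmorrey p q γ Q g := by
  unfold lmorrey
  gcongr with ρ _ z _
  refine lmixed_mono hp hq fun w => Set.indicator_le_indicator ?_
  exact Set.indicator_le_indicator' (h w)

theorem lmorrey_const_mul_le (hp : 0 < p) (hq : 0 < q) (hQ : MeasurableSet Q)
    (hf : Measurable f) (c : ℝ≥0∞) :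
    lmorrey p q γ Q (fun z => c * f z) ≤ c * lmorrey p q γ Q f := by
  refine lmorrey_le_of_forall_lmixed_le hp hq fun ρ hρ z hz => ?_
  have hind : (cylinder (ρ : ℝ≥0∞) z).indicator (Q.indicator fun w => c * f w) =
      fun w => c * (cylinder (ρ : ℝ≥0∞) z).indicator (Q.indicator f) w := by
    funext w
    simp only [Set.indicator_indicator, Set.indicator_mul_right _ fun _ => c]
  rw [hind, lmixed_const_mul hp hq ((hf.indicator hQ).indicator (measurableSet_cylinder _ _)),
    mul_assoc]
  gcongr
  exact (lmixed_cylinder_le_lmorrey hp hq γ hρ hz).trans_eq (by ring)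

theorem lmorrey_add_le (hp : 1 ≤ p) (hq : 1 ≤ q) (hQ : MeasurableSet Q) (hf : Measurable f)
    (hg : Measurable g) :
    lmorrey p q γ Q (fun z => f z + g z) ≤ lmorrey p q γ Q f + lmorrey p q γ Q g := by
  have hp0 : 0 < p := by linarith
  have hq0 : 0 < q := by linarith
  refine lmorrey_le_of_forall_lmixed_le hp0 hq0 fun ρ hρ z hz => ?_
  have hC := measurableSet_cylinder (ρ : ℝ≥0∞) z
  simp only [Set.indicator_add]
  refine (lmixed_add_le hp hq ((hf.indicator hQ).indicator hC)
    ((hg.indicator hQ).indicator hC)).trans ?_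
  rw [add_mul]
  gcongr
  · exact (lmixed_cylinder_le_lmorrey hp0 hq0 γ hρ hz).trans_eq (by ring)
  · exact (lmixed_cylinder_le_lmorrey hp0 hq0 γ hρ hz).trans_eq (by ring)

theorem lmorrey_cylinder_one_le (hp : 0 < p) (hq : 0 < q) (hγ : 0 < γ) (hγ' : γ ≤ d / p + 2 / q)
    {R : ℝ≥0∞} (hR : 0 < R) :
    lmorrey p q γ (cylinder R (0 : SpaceTime d)) (fun _ => 1) ≤ R ^ γ := by
  induction R with
  | top => exact (ENNReal.top_rpow_of_pos hγ).symm ▸ le_top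
  | coe R =>
    have hR0 : 0 < R := ENNReal.coe_pos.1 hR
    refine lmorrey_le_of_forall_lmixed_le hp hq fun ρ hρ z _ => ?_
    have hρ0 : (ρ : ℝ≥0∞) ≠ 0 := ENNReal.coe_ne_zero.2 hρ.ne'
    rw [Set.indicator_indicator]
    rcases le_total ρ R with hρR | hRρ
    · have hone : 1 ≤ (R : ℝ≥0∞) ^ γ * (ρ : ℝ≥0∞) ^ (-γ) := by
        rw [ENNReal.rpow_neg, ← div_eq_mul_inv, ENNReal.le_div_iff_mul_le (by simp [hρ0])
          (by simp [hγ.le]), one_mul]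
        gcongr
      rw [← mul_assoc]
      refine (lmixed_mono hp.le hq.le ?_).trans (le_mul_of_one_le_left' hone)
      exact Set.indicator_le_indicator_of_subset Set.inter_subset_left fun _ => zero_le
    · calc lmixed p q ((cylinder (ρ : ℝ≥0∞) z ∩ cylinder R 0).indicator fun _ => 1)
          ≤ lmixed p q ((cylinder (R : ℝ≥0∞) (0 : SpaceTime d)).indicator fun _ => 1) :=
            lmixed_mono hp.le hq.le <|
              Set.indicator_le_indicator_of_subset Set.inter_subset_right fun _ => zero_le
        _ = (R : ℝ≥0∞) ^ γ * (unitVol d ^ (1 / p) * (R : ℝ≥0∞) ^ (-γ + (d / p + 2 / q))) := by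
            rw [lmixed_indicator_cylinder_one hp hq hR0, mul_left_comm,
              ← ENNReal.rpow_add _ _ (by simpa using hR0.ne') ENNReal.coe_ne_top,
              add_neg_cancel_left]
        _ ≤ (R : ℝ≥0∞) ^ γ * (unitVol d ^ (1 / p) * (ρ : ℝ≥0∞) ^ (-γ + (d / p + 2 / q))) := by
            gcongr
            linarith
        _ = _ := by
            rw [lmixed_indicator_cylinder_one hp hq hρ, mul_left_comm ((ρ : ℝ≥0∞) ^ (-γ)),
              ENNReal.rpow_add _ _ hρ0 ENNReal.coe_ne_top]

end MorreyOrder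

section ParabolicBoxes

variable {d : ℕ} {p q : ℝ} {f : SpaceTime d → ℝ≥0∞}

/-- The two-sided parabolic cylinder of radius `r` centred at `z`. -/
def parBox (z : SpaceTime d) (r : ℝ) : Set (SpaceTime d) :=
  Metric.ball z.1 (r ^ 2) ×ˢ Metric.ball z.2 r

theorem measurableSet_parBox (z : SpaceTime d) (r : ℝ) : MeasurableSet (parBox z r) :=
  measurableSet_ball.prod measurableSet_ball

theorem parBox_subset_parBox {z₀ z : SpaceTime d} {ρ : ℝ≥0} (hz : z ∈ cylinder (ρ : ℝ≥0∞) z₀)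
    {l : ℝ} (hl : 0 < l) (hlρ : l ≤ ρ) : parBox z (2 * l) ⊆ parBox z₀ (3 * ρ) := by
  obtain ⟨hspace, hleft, hright⟩ := (mem_cylinder_coe ρ z₀ z).1 hz
  have hsq : l ^ 2 ≤ (ρ : ℝ) ^ 2 := by gcongr
  refine Set.prod_mono ?_ (Metric.ball_subset_ball' ?_)
  · refine Metric.ball_subset_ball' ?_
    rw [Real.dist_eq, abs_of_nonneg (by linarith)]
    nlinarith
  · rw [dist_comm]
    linarith

theorem exists_parBox_inter_subset_cylinder (R : ℝ≥0∞) {z : SpaceTime d} (hz : z ∈ cylinder R 0)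
    {r : ℝ≥0} (hr : 0 < r) : ∃ w ∈ cylinder R (0 : SpaceTime d),
      parBox z r ∩ cylinder R 0 ⊆ cylinder ((2 * r : ℝ≥0) : ℝ≥0∞) w := by
  obtain ⟨hspace, htime, hlt⟩ := hz
  simp only [Prod.fst_zero, sub_zero] at htime hlt
  have hr2 : (0 : ℝ) < (r : ℝ) ^ 2 := by positivity
  refine ⟨(max 0 (z.1 - (r : ℝ) ^ 2), z.2), ⟨hspace, le_max_left _ _, ?_⟩, ?_⟩
  · refine lt_of_le_of_lt (ENNReal.ofReal_le_ofReal ?_) hlt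
    simp only [Prod.fst_zero, sub_zero]
    exact max_le htime (by linarith)
  · rintro w ⟨⟨hwt, hwx⟩, -, hw0, -⟩
    rw [Metric.mem_ball] at hwx
    rw [Metric.mem_ball, Real.dist_eq, abs_lt] at hwt
    have hmax := le_max_right 0 (z.1 - (r : ℝ) ^ 2)
    rw [mem_cylinder_coe, dist_comm]
    push_cast
    exact ⟨by linarith, max_le hw0 (by linarith), by nlinarith⟩

theorem setLIntegral_parBox_le_lmorrey (hp : 1 ≤ p) (hq : 1 ≤ q) (β : ℝ) (R : ℝ≥0∞)
    (hf : Measurable f) {r : ℝ≥0} (hr : 0 < r) {z : SpaceTime d} (hz : z ∈ cylinder R 0) :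
    ∫⁻ w in parBox z r, (cylinder R 0).indicator f w ≤
      ((2 * r : ℝ≥0) : ℝ≥0∞) ^ (d + 2 - β) * unitVol d * lmorrey p q β (cylinder R 0) f := by
  have hQ := measurableSet_cylinder (d := d) R 0
  obtain ⟨w, hw, hsub⟩ := exists_parBox_inter_subset_cylinder R hz hr
  refine le_trans ?_ (setLIntegral_cylinder_le_lmorrey hp hq β hQ hf (by positivity) hw)
  rw [setLIntegral_indicator hQ, setLIntegral_indicator hQ]
  exact lintegral_mono_set fun x hx => ⟨hx.1, hsub ⟨hx.2, hx.1⟩⟩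

theorem lmixed_parBox_le_lmorrey (hp : 0 < p) (hq : 0 < q) (β : ℝ) (R : ℝ≥0∞)
    {r : ℝ≥0} (hr : 0 < r) {z : SpaceTime d} (hz : z ∈ cylinder R 0) :
    lmixed p q ((parBox z r).indicator ((cylinder R 0).indicator f)) ≤
      ((2 * r : ℝ≥0) : ℝ≥0∞) ^ (-β) * lmorrey p q β (cylinder R 0) f *
        (unitVol d ^ (1 / p) * ((2 * r : ℝ≥0) : ℝ≥0∞) ^ (d / p + 2 / q)) := by
  obtain ⟨w, hw, hsub⟩ := exists_parBox_inter_subset_cylinder R hz hr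
  have h2r : 0 < 2 * r := by positivity
  rw [← lmixed_indicator_cylinder_one hp hq h2r w]
  refine le_trans (lmixed_mono hp.le hq.le fun x => ?_)
    (lmixed_cylinder_le_lmorrey hp hq β h2r hw)
  rw [Set.indicator_indicator, Set.indicator_indicator]
  refine Set.indicator_le_indicator_of_subset ?_ (fun _ => zero_le) x
  exact fun y hy => ⟨hsub hy, hy.2⟩

end ParabolicBoxes

section Hedberg

variable {β : ℝ}

theorem lintegral_Ioi_rpow_neg (hβ : 1 < β) {m : ℝ} (hm : 0 < m) :
    ∫⁻ l in Set.Ioi m, ENNReal.ofReal l ^ (-β) = ENNReal.ofReal (m ^ (1 - β) / (β - 1)) := by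
  calc ∫⁻ l in Set.Ioi m, ENNReal.ofReal l ^ (-β)
      = ∫⁻ l in Set.Ioi m, ENNReal.ofReal (l ^ (-β)) :=
        setLIntegral_congr_fun measurableSet_Ioi fun l hl =>
          ENNReal.ofReal_rpow_of_pos (hm.trans hl)
    _ = ENNReal.ofReal (∫ l in Set.Ioi m, l ^ (-β)) := by
        refine (ofReal_integral_eq_lintegral_ofReal
          (integrableOn_Ioi_rpow_of_lt (by linarith) hm) ?_).symm
        filter_upwards [ae_restrict_mem measurableSet_Ioi] with l hl
        exact Real.rpow_nonneg (hm.trans hl).le _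
    _ = ENNReal.ofReal (m ^ (1 - β) / (β - 1)) := by
        rw [integral_Ioi_rpow_of_lt (by linarith) hm, ← neg_div_neg_eq, neg_neg,
          neg_add_eq_sub, neg_sub]

theorem setLIntegral_Ioi_le_of_le_rpow_neg (hβ : 1 < β) {B : ℝ≥0∞} {h : ℝ → ℝ≥0∞}
    (hB : ∀ l, 0 < l → h l ≤ B * ENNReal.ofReal l ^ (-β)) {m : ℝ} (hm : 0 < m) :
    ∫⁻ l in Set.Ioi m, h l ≤ B * ENNReal.ofReal (m ^ (1 - β) / (β - 1)) := by
  calc ∫⁻ l in Set.Ioi m, h l ≤ ∫⁻ l in Set.Ioi m, B * ENNReal.ofReal l ^ (-β) :=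
        setLIntegral_mono' measurableSet_Ioi fun l hl => hB l (hm.trans hl)
    _ = B * ENNReal.ofReal (m ^ (1 - β) / (β - 1)) := by
        rw [lintegral_const_mul _ (by fun_prop), lintegral_Ioi_rpow_neg hβ hm]

theorem lintegral_Ioi_le_add (hβ : 1 < β) {A B : ℝ≥0∞} {h : ℝ → ℝ≥0∞}
    (hA : ∀ l, 0 < l → h l ≤ A) (hB : ∀ l, 0 < l → h l ≤ B * ENNReal.ofReal l ^ (-β))
    {m : ℝ} (hm : 0 < m) :
    ∫⁻ l in Set.Ioi 0, h l ≤
      A * ENNReal.ofReal m + B * ENNReal.ofReal (m ^ (1 - β) / (β - 1)) := by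
  have hnear : ∫⁻ l in Set.Ioc 0 m, h l ≤ A * ENNReal.ofReal m := by
    calc ∫⁻ l in Set.Ioc 0 m, h l ≤ ∫⁻ _ in Set.Ioc 0 m, A :=
          setLIntegral_mono' measurableSet_Ioc fun l hl => hA l hl.1
      _ = A * ENNReal.ofReal m := by rw [setLIntegral_const, Real.volume_Ioc, sub_zero]
  rw [← Set.Ioc_union_Ioi_eq_Ioi hm.le]
  exact (lintegral_union_le _ _ _).trans
    (add_le_add hnear (setLIntegral_Ioi_le_of_le_rpow_neg hβ hB hm))

-- The two terms of `lintegral_Ioi_le_add` balance at `m = (B / A) ^ (1 / β)`.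
theorem lintegral_Ioi_le_of_le_of_le_nnreal (hβ : 1 < β) {A B : ℝ≥0} (hA0 : 0 < A) (hB0 : 0 < B)
    {h : ℝ → ℝ≥0∞} (hA : ∀ l, 0 < l → h l ≤ A)
    (hB : ∀ l, 0 < l → h l ≤ B * ENNReal.ofReal l ^ (-β)) :
    ∫⁻ l in Set.Ioi 0, h l ≤ ENNReal.ofReal (1 + 1 / (β - 1)) *
      ((A : ℝ≥0∞) ^ (1 - 1 / β) * (B : ℝ≥0∞) ^ (1 / β)) := by
  have ha : (0 : ℝ) < A := NNReal.coe_pos.2 hA0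
  have hb : (0 : ℝ) < B := NNReal.coe_pos.2 hB0
  set m : ℝ := ((B : ℝ) / A) ^ (1 / β) with hm
  have hm0 : 0 < m := by positivity
  have hnear : (A : ℝ) * m = (A : ℝ) ^ (1 - 1 / β) * (B : ℝ) ^ (1 / β) := by
    rw [hm, Real.div_rpow hb.le ha.le, Real.rpow_sub ha, Real.rpow_one]
    field_simp
  have hfar : (B : ℝ) * m ^ (1 - β) = (A : ℝ) ^ (1 - 1 / β) * (B : ℝ) ^ (1 / β) := by
    rw [← hnear, Real.rpow_sub hm0, Real.rpow_one, hm, ← Real.rpow_mul (by positivity),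
      one_div_mul_cancel (by linarith), Real.rpow_one]
    field_simp
  have : 0 < β - 1 := sub_pos.2 hβ
  refine (lintegral_Ioi_le_add hβ hA hB hm0).trans_eq ?_
  rw [← ENNReal.ofReal_coe_nnreal (p := A), ← ENNReal.ofReal_coe_nnreal (p := B),
    ENNReal.ofReal_rpow_of_pos ha, ENNReal.ofReal_rpow_of_pos hb, ← ENNReal.ofReal_mul ha.le,
    ← ENNReal.ofReal_mul hb.le, ← ENNReal.ofReal_mul (by positivity),
    ← ENNReal.ofReal_mul (by positivity), ← ENNReal.ofReal_add (by positivity) (by positivity),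
    ← mul_div_assoc, hfar, hnear]
  congr 1
  ring

theorem lintegral_Ioi_le_of_le_of_le (hβ : 1 < β) {A B : ℝ≥0∞} {h : ℝ → ℝ≥0∞}
    (hA : ∀ l, 0 < l → h l ≤ A) (hB : ∀ l, 0 < l → h l ≤ B * ENNReal.ofReal l ^ (-β)) :
    ∫⁻ l in Set.Ioi 0, h l ≤
      ENNReal.ofReal (1 + 1 / (β - 1)) * (A ^ (1 - 1 / β) * B ^ (1 / β)) := by
  have : 0 < β - 1 := sub_pos.2 hβ
  have hβ' : 0 < 1 / β := by positivity
  have hκ : 0 < 1 - 1 / β := sub_pos.2 ((div_lt_one (by linarith)).2 hβ)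
  have hC : ENNReal.ofReal (1 + 1 / (β - 1)) ≠ 0 := (ENNReal.ofReal_pos.2 (by positivity)).ne'
  have hzero (h0 : ∀ l, 0 < l → h l ≤ 0) : ∫⁻ l in Set.Ioi 0, h l = 0 := by
    rw [setLIntegral_congr_fun measurableSet_Ioi fun l hl => nonpos_iff_eq_zero.1 (h0 l hl),
      lintegral_zero]
  rcases eq_or_ne A 0 with rfl | hA0
  · exact (hzero hA).trans_le zero_le
  rcases eq_or_ne B 0 with rfl | hB0
  · exact (hzero fun l hl => (hB l hl).trans_eq (zero_mul _)).trans_le zero_le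
  have hA1 : A ^ (1 - 1 / β) ≠ 0 := mt (ENNReal.rpow_eq_zero_iff_of_pos hκ).1 hA0
  have hB1 : B ^ (1 / β) ≠ 0 := mt (ENNReal.rpow_eq_zero_iff_of_pos hβ').1 hB0
  rcases eq_or_ne A ⊤ with rfl | hAt
  · rw [ENNReal.top_rpow_of_pos hκ, ENNReal.top_mul hB1, ENNReal.mul_top hC]
    exact le_top
  rcases eq_or_ne B ⊤ with rfl | hBt
  · rw [ENNReal.top_rpow_of_pos hβ', ENNReal.mul_top hA1, ENNReal.mul_top hC]
    exact le_top
  lift A to ℝ≥0 using hAt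
  lift B to ℝ≥0 using hBt
  exact lintegral_Ioi_le_of_le_of_le_nnreal hβ (pos_iff_ne_zero.2 (by simpa using hA0))
    (pos_iff_ne_zero.2 (by simpa using hB0)) hA hB

end Hedberg

section Derivatives

variable {d : ℕ} {u : SpaceTime d → ℝ}

theorem timeDeriv_eq_fderiv {z : SpaceTime d} (hu : DifferentiableAt ℝ u z) :
    timeDeriv u z = fderiv ℝ u z (1, 0) :=
  (hu.hasFDerivAt.comp_hasDerivAt z.1
    ((hasDerivAt_id z.1).prodMk (hasDerivAt_const z.1 z.2))).deriv

theorem spaceDeriv_eq_fderiv {z : SpaceTime d} (hu : DifferentiableAt ℝ u z) (i : Fin d) :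
    spaceDeriv i u z = fderiv ℝ u z (0, EuclideanSpace.single i 1) := by
  have hslice : HasFDerivAt (fun y => u (z.1, y))
      (fderiv ℝ u z ∘L (0 : EuclideanSpace ℝ (Fin d) →L[ℝ] ℝ).prod (.id ℝ _)) z.2 :=
    hu.hasFDerivAt.comp z.2 ((hasFDerivAt_const z.1 z.2).prodMk (hasFDerivAt_id z.2))
  rw [spaceDeriv, hslice.fderiv]
  rfl

theorem contDiff_timeDeriv {m n : WithTop ℕ∞} (hu : ContDiff ℝ n u) (hmn : m + 1 ≤ n) :
    ContDiff ℝ m (timeDeriv u) := by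
  have hd : Differentiable ℝ u := (hu.of_le (le_add_self.trans hmn)).differentiable one_ne_zero
  have heq : timeDeriv u = fun z => fderiv ℝ u z (1, 0) :=
    funext fun z => timeDeriv_eq_fderiv (hd z)
  rw [heq]
  exact (hu.fderiv_right hmn).clm_apply contDiff_const

theorem contDiff_spaceDeriv {m n : WithTop ℕ∞} (hu : ContDiff ℝ n u) (hmn : m + 1 ≤ n)
    (i : Fin d) : ContDiff ℝ m (spaceDeriv i u) := by
  have hd : Differentiable ℝ u := (hu.of_le (le_add_self.trans hmn)).differentiable one_ne_zero
  have heq : spaceDeriv i u = fun z => fderiv ℝ u z (0, EuclideanSpace.single i 1) :=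
    funext fun z => spaceDeriv_eq_fderiv (hd z) i
  rw [heq]
  exact (hu.fderiv_right hmn).clm_apply contDiff_const

theorem continuous_timeDeriv (hu : ContDiff ℝ 1 u) : Continuous (timeDeriv u) :=
  (contDiff_timeDeriv (m := 0) hu (by simp)).continuous

theorem continuous_spaceDeriv (hu : ContDiff ℝ 1 u) (i : Fin d) :
    Continuous (spaceDeriv i u) :=
  (contDiff_spaceDeriv (m := 0) hu (by simp) i).continuous

theorem contDiff_one_spaceDeriv (hu : ContDiff ℝ 2 u) (i : Fin d) :
    ContDiff ℝ 1 (spaceDeriv i u) :=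
  contDiff_spaceDeriv hu one_add_one_eq_two.le i

theorem contDiff_one_timeDeriv (hu : ContDiff ℝ 2 u) : ContDiff ℝ 1 (timeDeriv u) :=
  contDiff_timeDeriv hu one_add_one_eq_two.le

theorem continuous_spaceHess (hu : ContDiff ℝ 2 u) : Continuous (spaceHess u) :=
  (PiLp.continuous_toLp 2 _).comp <| continuous_pi fun p =>
    continuous_spaceDeriv (contDiff_one_spaceDeriv hu p.2) p.1

theorem fderiv_fderiv_apply (hu : ContDiff ℝ 2 u) (z v w : SpaceTime d) :
    fderiv ℝ (fun z => fderiv ℝ u z v) z w = fderiv ℝ (fderiv ℝ u) z w v := by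
  have hd : DifferentiableAt ℝ (fderiv ℝ u) z :=
    (hu.fderiv_right (m := 1) one_add_one_eq_two.le).differentiable one_ne_zero z
  simp [fderiv_clm_apply hd (differentiableAt_const v)]

theorem timeDeriv_spaceDeriv (hu : ContDiff ℝ 2 u) (i : Fin d) (z : SpaceTime d) :
    timeDeriv (spaceDeriv i u) z = spaceDeriv i (timeDeriv u) z := by
  have hd : Differentiable ℝ u := hu.differentiable two_ne_zero
  have ht : timeDeriv u = fun z => fderiv ℝ u z (1, 0) :=
    funext fun z => timeDeriv_eq_fderiv (hd z)
  have hx : spaceDeriv i u = fun z => fderiv ℝ u z (0, EuclideanSpace.single i 1) :=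
    funext fun z => spaceDeriv_eq_fderiv (hd z) i
  rw [timeDeriv_eq_fderiv ((contDiff_one_spaceDeriv hu i).differentiable one_ne_zero z),
    spaceDeriv_eq_fderiv ((contDiff_one_timeDeriv hu).differentiable one_ne_zero z),
    ht, hx, fderiv_fderiv_apply hu, fderiv_fderiv_apply hu]
  exact hu.contDiffAt.isSymmSndFDerivAt (by simp) _ _

end Derivatives

section ParabolicPaths

variable {d : ℕ} {u : SpaceTime d → ℝ} {ψ : EuclideanSpace ℝ (Fin d) → ℝ}

/-- The path `l ↦ z + (l² a, l (ξ + e))`, which starts at `z` and is adapted to the parabolic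
scaling. Averages over `ξ` in a ball are the means in the integral representation; `a` and `e`
steer the path into a prescribed cylinder. -/
def parPath (z : SpaceTime d) (a : ℝ) (e ξ : EuclideanSpace ℝ (Fin d)) (l : ℝ) : SpaceTime d :=
  (z.1 + l ^ 2 * a, z.2 + l • (ξ + e))

/-- The sum `|∂ₜu| + |D²u|`. -/
abbrev heatSize (u : SpaceTime d → ℝ) (z : SpaceTime d) : ℝ := |timeDeriv u z| + ‖spaceHess u z‖

theorem continuous_heatSize (hu : ContDiff ℝ 2 u) : Continuous (heatSize u) :=
  (contDiff_one_timeDeriv hu).continuous.abs.add (continuous_spaceHess hu).norm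

theorem abs_spaceDeriv_spaceDeriv_le (u : SpaceTime d → ℝ) (z : SpaceTime d) (i j : Fin d) :
    |spaceDeriv j (spaceDeriv i u) z| ≤ ‖spaceHess u z‖ :=
  PiLp.norm_apply_le (spaceHess u z) (j, i)

theorem parPath_zero (z : SpaceTime d) (a : ℝ) (e ξ : EuclideanSpace ℝ (Fin d)) :
    parPath z a e ξ 0 = z := by
  simp [parPath]

theorem continuous_parPath (z : SpaceTime d) (a : ℝ) (e : EuclideanSpace ℝ (Fin d)) :
    Continuous fun p : ℝ × EuclideanSpace ℝ (Fin d) => parPath z a e p.2 p.1 := by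
  unfold parPath
  fun_prop

theorem continuous_parPath_left (z : SpaceTime d) (a : ℝ) (e : EuclideanSpace ℝ (Fin d))
    (l : ℝ) : Continuous fun ξ => parPath z a e ξ l :=
  (continuous_parPath z a e).comp (Continuous.prodMk_right l)

theorem hasDerivAt_parPath (hu : Differentiable ℝ u) (z : SpaceTime d) (a : ℝ)
    (e ξ : EuclideanSpace ℝ (Fin d)) (l : ℝ) :
    HasDerivAt (fun l => u (parPath z a e ξ l))
      (2 * l * a * timeDeriv u (parPath z a e ξ l) +
        ∑ j, (ξ + e) j * spaceDeriv j u (parPath z a e ξ l)) l := by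
  have hpath : HasDerivAt (parPath z a e ξ) (2 * l * a, ξ + e) l := by
    refine HasDerivAt.prodMk ?_ ?_
    · simpa using (((hasDerivAt_id l).pow 2).mul_const a).const_add z.1
    · simpa using ((hasDerivAt_id l).smul_const (ξ + e)).const_add z.2
  have hvec : ((2 * l * a, ξ + e) : SpaceTime d) =
      (2 * l * a) • ((1 : ℝ), (0 : EuclideanSpace ℝ (Fin d))) +
        ∑ j, (ξ + e) j • ((0 : ℝ), EuclideanSpace.single j (1 : ℝ)) := by
    ext k
    · simp [Prod.fst_sum]
    · simp [Prod.snd_sum, Finset.sum_apply, Pi.single_apply]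
  refine ((hu (parPath z a e ξ l)).hasFDerivAt.comp_hasDerivAt l hpath).congr_deriv ?_
  simp only [timeDeriv_eq_fderiv (hu _), spaceDeriv_eq_fderiv (hu _), hvec, map_add, map_smul,
    map_sum, smul_eq_mul]

theorem hasFDerivAt_parPath (hu : Differentiable ℝ u) (z : SpaceTime d) (a : ℝ)
    (e ξ : EuclideanSpace ℝ (Fin d)) (l : ℝ) :
    HasFDerivAt (fun ξ => u (parPath z a e ξ l))
      (fderiv ℝ u (parPath z a e ξ l) ∘L
        (0 : EuclideanSpace ℝ (Fin d) →L[ℝ] ℝ).prod (l • ContinuousLinearMap.id ℝ _)) ξ :=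
  (hu (parPath z a e ξ l)).hasFDerivAt.comp ξ <| (hasFDerivAt_const _ _).prodMk <|
    (((hasFDerivAt_id ξ).add_const e).const_smul l).const_add z.2

theorem fderiv_parPath (hu : Differentiable ℝ u) (z : SpaceTime d) (a : ℝ)
    (e ξ : EuclideanSpace ℝ (Fin d)) (l : ℝ) (i : Fin d) :
    fderiv ℝ (fun ξ => u (parPath z a e ξ l)) ξ (EuclideanSpace.single i 1) =
      l * spaceDeriv i u (parPath z a e ξ l) := by
  rw [(hasFDerivAt_parPath hu z a e ξ l).fderiv, spaceDeriv_eq_fderiv (hu _), ← smul_eq_mul,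
    ← map_smul]
  simp

theorem integral_mul_spaceDeriv_parPath (hu : ContDiff ℝ 1 u) (hψ : ContDiff ℝ 1 ψ)
    (hψc : HasCompactSupport ψ) (z : SpaceTime d) (a : ℝ) (e : EuclideanSpace ℝ (Fin d)) (l : ℝ)
    (i : Fin d) :
    ∫ ξ, ψ ξ * (l * spaceDeriv i u (parPath z a e ξ l)) =
      -∫ ξ, fderiv ℝ ψ ξ (EuclideanSpace.single i 1) * u (parPath z a e ξ l) := by
  have hd : Differentiable ℝ u := hu.differentiable one_ne_zero
  have hpc := continuous_parPath_left z a e l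
  have huc : Continuous fun ξ => u (parPath z a e ξ l) := hu.continuous.comp hpc
  have hdc : Continuous fun ξ => l * spaceDeriv i u (parPath z a e ξ l) :=
    continuous_const.mul ((continuous_spaceDeriv hu i).comp hpc)
  have hψ' : Continuous fun ξ => fderiv ℝ ψ ξ (EuclideanSpace.single i 1) :=
    (hψ.continuous_fderiv one_ne_zero).clm_apply continuous_const
  simp_rw [← fun ξ => fderiv_parPath hd z a e ξ l i] at hdc ⊢
  refine integral_mul_fderiv_eq_neg_fderiv_mul_of_integrable ?_ ?_ ?_ ?_ ?_
  · exact (hψ'.mul huc).integrable_of_hasCompactSupport (hψc.fderiv_apply (𝕜 := ℝ) _).mul_right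
  · exact (hψ.continuous.mul hdc).integrable_of_hasCompactSupport hψc.mul_right
  · exact (hψ.continuous.mul huc).integrable_of_hasCompactSupport hψc.mul_right
  · exact fun ξ _ => hψ.differentiable one_ne_zero ξ
  · exact fun ξ _ => (hasFDerivAt_parPath hd z a e ξ l).differentiableAt

theorem integrable_uIoc_prod_of_hasCompactSupport {X : Type*} [TopologicalSpace X] [T2Space X]
    [MeasurableSpace X] [OpensMeasurableSpace X] [SecondCountableTopology X]
    {μ : Measure X} [SFinite μ] [IsFiniteMeasureOnCompacts μ] {ψ : X → ℝ}
    (hψ : Continuous ψ) (hψc : HasCompactSupport ψ) {V : ℝ → X → ℝ}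
    (hV : Continuous (Function.uncurry V)) (a b : ℝ) :
    Integrable (Function.uncurry fun l ξ => ψ ξ * V l ξ)
      ((volume.restrict (Set.uIoc a b)).prod μ) := by
  have hcont : Continuous (Function.uncurry fun l ξ => ψ ξ * V l ξ) :=
    (hψ.comp continuous_snd).mul hV
  have hcompact : IntegrableOn (Function.uncurry fun l ξ => ψ ξ * V l ξ)
      (Set.uIcc a b ×ˢ tsupport ψ) (volume.prod μ) :=
    hcont.continuousOn.integrableOn_compact (isCompact_uIcc.prod hψc)
  have hstrip : IntegrableOn (Function.uncurry fun l ξ => ψ ξ * V l ξ)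
      (Set.uIoc a b ×ˢ Set.univ) (volume.prod μ) := by
    refine hcompact.of_forall_sdiff_eq_zero (measurableSet_uIoc.prod MeasurableSet.univ) ?_
    rintro ⟨l, ξ⟩ ⟨⟨hl, -⟩, hnot⟩
    have hξ : ξ ∉ tsupport ψ := fun h => hnot ⟨Set.uIoc_subset_uIcc hl, h⟩
    simp [Function.uncurry, image_eq_zero_of_notMem_tsupport hξ]
  rwa [IntegrableOn, ← Measure.prod_restrict, Measure.restrict_univ] at hstrip

theorem integral_mul_eq_sub_intervalIntegral {X : Type*} [TopologicalSpace X] [T2Space X]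
    [MeasurableSpace X] [OpensMeasurableSpace X] [SecondCountableTopology X]
    {μ : Measure X} [SFinite μ] [IsFiniteMeasureOnCompacts μ] {ψ : X → ℝ}
    (hψ : Continuous ψ) (hψc : HasCompactSupport ψ) {G V : ℝ → X → ℝ}
    (hG : ∀ l, Continuous (G l)) (hV : Continuous (Function.uncurry V))
    (hGV : ∀ l ξ, HasDerivAt (fun l => G l ξ) (V l ξ) l) (a b : ℝ) :
    ∫ ξ, ψ ξ * G a ξ ∂μ =
      (∫ ξ, ψ ξ * G b ξ ∂μ) - ∫ l in a..b, ∫ ξ, ψ ξ * V l ξ ∂μ := by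
  have hint (l : ℝ) : Integrable (fun ξ => ψ ξ * G l ξ) μ :=
    (hψ.mul (hG l)).integrable_of_hasCompactSupport hψc.mul_right
  rw [eq_sub_iff_add_eq', ← eq_sub_iff_add_eq, ← integral_sub (hint b) (hint a),
    intervalIntegral_integral_swap (integrable_uIoc_prod_of_hasCompactSupport hψ hψc hV a b)]
  refine integral_congr_ae (Filter.Eventually.of_forall fun ξ => ?_)
  simp only
  rw [intervalIntegral.integral_const_mul, intervalIntegral.integral_eq_sub_of_hasDerivAt
    (fun l _ => hGV l ξ) ((hV.comp (Continuous.prodMk_left ξ)).intervalIntegrable _ _), mul_sub]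

/-- The density whose integral over `ξ` and `l` is the second term of `spaceDeriv_eq_integral`. -/
def parKernel (u : SpaceTime d → ℝ) (ψ : EuclideanSpace ℝ (Fin d) → ℝ) (z : SpaceTime d) (a : ℝ)
    (e : EuclideanSpace ℝ (Fin d)) (i : Fin d) (l : ℝ) (ξ : EuclideanSpace ℝ (Fin d)) : ℝ :=
  -(2 * a * (fderiv ℝ ψ ξ (EuclideanSpace.single i 1) * timeDeriv u (parPath z a e ξ l))) +
    ψ ξ * ∑ j, (ξ + e) j * spaceDeriv j (spaceDeriv i u) (parPath z a e ξ l)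

theorem integral_mul_deriv_spaceDeriv_parPath (hu : ContDiff ℝ 2 u) (hψ : ContDiff ℝ 1 ψ)
    (hψc : HasCompactSupport ψ) (z : SpaceTime d) (a : ℝ) (e : EuclideanSpace ℝ (Fin d))
    (i : Fin d) (l : ℝ) :
    ∫ ξ, ψ ξ * (2 * l * a * timeDeriv (spaceDeriv i u) (parPath z a e ξ l) +
        ∑ j, (ξ + e) j * spaceDeriv j (spaceDeriv i u) (parPath z a e ξ l)) =
      ∫ ξ, parKernel u ψ z a e i l ξ := by
  have hv := contDiff_one_spaceDeriv hu i
  have hpl := continuous_parPath_left z a e l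
  have hψ' : Continuous fun ξ => fderiv ℝ ψ ξ (EuclideanSpace.single i 1) :=
    (hψ.continuous_fderiv one_ne_zero).clm_apply continuous_const
  have hintHess : Integrable fun ξ =>
      ψ ξ * ∑ j, (ξ + e) j * spaceDeriv j (spaceDeriv i u) (parPath z a e ξ l) :=
    (hψ.continuous.mul (continuous_finsetSum _ fun j _ => Continuous.mul (by fun_prop)
      ((continuous_spaceDeriv hv j).comp hpl))).integrable_of_hasCompactSupport hψc.mul_right
  have hintTime : Integrable fun ξ =>
      ψ ξ * (2 * l * a * timeDeriv (spaceDeriv i u) (parPath z a e ξ l)) :=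
    (hψ.continuous.mul (continuous_const.mul
      ((continuous_timeDeriv hv).comp hpl))).integrable_of_hasCompactSupport hψc.mul_right
  have hintParts : Integrable fun ξ =>
      fderiv ℝ ψ ξ (EuclideanSpace.single i 1) * timeDeriv u (parPath z a e ξ l) :=
    (hψ'.mul ((contDiff_one_timeDeriv hu).continuous.comp hpl)).integrable_of_hasCompactSupport
      (hψc.fderiv_apply (𝕜 := ℝ) _).mul_right
  simp only [parKernel, mul_add (ψ _)]
  have hintNeg : Integrable fun ξ =>
      -(2 * a * (fderiv ℝ ψ ξ (EuclideanSpace.single i 1) * timeDeriv u (parPath z a e ξ l))) :=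
    (hintParts.const_mul (2 * a)).neg
  rw [integral_add hintTime hintHess, integral_add hintNeg hintHess]
  congr 1
  rw [integral_neg, integral_const_mul, ← mul_neg,
    ← integral_mul_spaceDeriv_parPath (contDiff_one_timeDeriv hu) hψ hψc, ← integral_const_mul]
  refine integral_congr_ae (Filter.Eventually.of_forall fun ξ => ?_)
  simp only [timeDeriv_spaceDeriv hu i]
  ring

theorem spaceDeriv_eq_integral (hu : ContDiff ℝ 2 u) (hψ : ContDiff ℝ 1 ψ)
    (hψc : HasCompactSupport ψ) (hψ1 : ∫ ξ, ψ ξ = 1) (z : SpaceTime d) (a : ℝ)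
    (e : EuclideanSpace ℝ (Fin d)) {L : ℝ} (hL : L ≠ 0) (i : Fin d) :
    spaceDeriv i u z =
      -(L⁻¹ * ∫ ξ, fderiv ℝ ψ ξ (EuclideanSpace.single i 1) * u (parPath z a e ξ L)) -
        ∫ l in (0 : ℝ)..L, ∫ ξ, parKernel u ψ z a e i l ξ := by
  have hv := contDiff_one_spaceDeriv hu i
  have hpath := continuous_parPath z a e
  have hV : Continuous (Function.uncurry fun l ξ =>
      2 * l * a * timeDeriv (spaceDeriv i u) (parPath z a e ξ l) +
        ∑ j, (ξ + e) j * spaceDeriv j (spaceDeriv i u) (parPath z a e ξ l)) := by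
    refine Continuous.add (Continuous.mul (by fun_prop) ((continuous_timeDeriv hv).comp hpath)) ?_
    refine continuous_finsetSum _ fun j _ => Continuous.mul ?_
      ((continuous_spaceDeriv hv j).comp hpath)
    fun_prop
  have hend : ∫ ξ, ψ ξ * spaceDeriv i u (parPath z a e ξ L) =
      -(L⁻¹ * ∫ ξ, fderiv ℝ ψ ξ (EuclideanSpace.single i 1) * u (parPath z a e ξ L)) := by
    rw [← mul_neg, ← integral_mul_spaceDeriv_parPath (hu.of_le one_le_two) hψ hψc,
      ← integral_const_mul]
    refine integral_congr_ae (Filter.Eventually.of_forall fun ξ => ?_)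
    simp only
    field_simp
  calc spaceDeriv i u z = ∫ ξ, ψ ξ * spaceDeriv i u (parPath z a e ξ 0) := by
        simp only [parPath_zero, integral_mul_const, hψ1, one_mul]
    _ = _ := integral_mul_eq_sub_intervalIntegral hψ.continuous hψc
        (fun l => hv.continuous.comp (continuous_parPath_left z a e l)) hV
        (fun l ξ => hasDerivAt_parPath (hv.differentiable one_ne_zero) z a e ξ l) 0 L
    _ = _ := by
        simp only [Function.comp_apply, hend, integral_mul_deriv_spaceDeriv_parPath hu hψ hψc]

end ParabolicPaths

section PathBound

variable {d : ℕ} {u : SpaceTime d → ℝ} {ψ : EuclideanSpace ℝ (Fin d) → ℝ}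

theorem exists_bump (d : ℕ) : ∃ (ψ : EuclideanSpace ℝ (Fin d) → ℝ) (C : ℝ≥0),
    ContDiff ℝ 1 ψ ∧ HasCompactSupport ψ ∧ tsupport ψ ⊆ Metric.ball 0 1 ∧ ∫ ξ, ψ ξ = 1 ∧
      (∀ ξ, |ψ ξ| ≤ C) ∧ ∀ ξ, ‖fderiv ℝ ψ ξ‖ ≤ C := by
  let b : ContDiffBump (0 : EuclideanSpace ℝ (Fin d)) := ⟨1 / 4, 1 / 2, by norm_num, by norm_num⟩
  have hψ : ContDiff ℝ 1 (b.normed volume) := b.contDiff_normed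
  have hc : HasCompactSupport (b.normed volume) := b.hasCompactSupport_normed
  obtain ⟨C₀, hC₀⟩ := hc.exists_bound_of_continuous hψ.continuous
  obtain ⟨C₁, hC₁⟩ := (hc.fderiv (𝕜 := ℝ)).exists_bound_of_continuous
    (hψ.continuous_fderiv one_ne_zero)
  refine ⟨b.normed volume, (max C₀ C₁).toNNReal, hψ, hc, ?_, b.integral_normed, fun ξ => ?_,
    fun ξ => ?_⟩
  · rw [b.tsupport_normed_eq]
    exact Metric.closedBall_subset_ball (by norm_num)
  · exact (hC₀ ξ).trans ((le_max_left _ _).trans (Real.le_coe_toNNReal _))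
  · exact (hC₁ ξ).trans ((le_max_right _ _).trans (Real.le_coe_toNNReal _))

theorem enorm_integral_le_mul_setLIntegral {X E F : Type*} [MeasurableSpace X] {μ : Measure X}
    [NormedAddCommGroup E] [NormedSpace ℝ E] [NormedAddCommGroup F] {s : Set X}
    (hs : MeasurableSet s) {G : X → E} {H : X → F} {C : ℝ≥0}
    (hGH : ∀ x ∈ s, ‖G x‖ ≤ C * ‖H x‖) (hG : ∀ x ∉ s, G x = 0) :
    ‖∫ x, G x ∂μ‖ₑ ≤ C * ∫⁻ x in s, ‖H x‖ₑ ∂μ := by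
  refine (enorm_integral_le_lintegral_enorm _).trans ?_
  rw [← lintegral_const_mul' _ _ ENNReal.coe_ne_top, ← lintegral_indicator hs]
  refine lintegral_mono fun x => ?_
  by_cases hx : x ∈ s
  · rw [Set.indicator_of_mem hx, enorm_eq_nnnorm, enorm_eq_nnnorm, ← ENNReal.coe_mul]
    exact ENNReal.coe_le_coe.2 (hGH x hx)
  · rw [hG x hx, enorm_zero]
    exact zero_le

theorem abs_sum_mul_spaceDeriv_le (u : SpaceTime d → ℝ) (z : SpaceTime d) (i : Fin d)
    (y : EuclideanSpace ℝ (Fin d)) :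
    |∑ j, y j * spaceDeriv j (spaceDeriv i u) z| ≤ d * (‖y‖ * ‖spaceHess u z‖) := by
  calc |∑ j, y j * spaceDeriv j (spaceDeriv i u) z|
      ≤ ∑ j : Fin d, |y j * spaceDeriv j (spaceDeriv i u) z| := Finset.abs_sum_le_sum_abs _ _
    _ ≤ ∑ _ : Fin d, ‖y‖ * ‖spaceHess u z‖ := by
        refine Finset.sum_le_sum fun j _ => ?_
        rw [abs_mul]
        exact mul_le_mul (PiLp.norm_apply_le y j) (abs_spaceDeriv_spaceDeriv_le u z i j)
          (abs_nonneg _) (norm_nonneg _)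
    _ = d * (‖y‖ * ‖spaceHess u z‖) := by
        rw [Finset.sum_const, Finset.card_univ, Fintype.card_fin, nsmul_eq_mul]

theorem abs_fderiv_single_le {C : ℝ} {ξ : EuclideanSpace ℝ (Fin d)} (h : ‖fderiv ℝ ψ ξ‖ ≤ C)
    (i : Fin d) : |fderiv ℝ ψ ξ (EuclideanSpace.single i 1)| ≤ C := by
  have hop := (fderiv ℝ ψ ξ).le_opNorm (EuclideanSpace.single i 1)
  rw [PiLp.norm_single, norm_one, mul_one] at hop
  exact hop.trans h

theorem abs_parKernel_le {C : ℝ} {ξ e : EuclideanSpace ℝ (Fin d)} (hψ : |ψ ξ| ≤ C)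
    (hψ' : ‖fderiv ℝ ψ ξ‖ ≤ C) {a : ℝ} (ha : |a| ≤ 1) (he : ‖e‖ ≤ 1) (hξ : ‖ξ‖ ≤ 1)
    (z : SpaceTime d) (i : Fin d) (l : ℝ) :
    |parKernel u ψ z a e i l ξ| ≤ C * (2 + 2 * d) * heatSize u (parPath z a e ξ l) := by
  set w := parPath z a e ξ l with hw
  have hC : 0 ≤ C := (abs_nonneg _).trans hψ
  have htime : |2 * a * (fderiv ℝ ψ ξ (EuclideanSpace.single i 1) * timeDeriv u w)| ≤
      2 * C * |timeDeriv u w| := by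
    rw [abs_mul, abs_mul, abs_mul, abs_two]
    calc 2 * |a| * (|fderiv ℝ ψ ξ (EuclideanSpace.single i 1)| * |timeDeriv u w|)
        ≤ 2 * 1 * (C * |timeDeriv u w|) := by gcongr; exact abs_fderiv_single_le hψ' i
      _ = 2 * C * |timeDeriv u w| := by ring
  have hspace : |ψ ξ * ∑ j, (ξ + e) j * spaceDeriv j (spaceDeriv i u) w| ≤
      C * (d * (2 * ‖spaceHess u w‖)) := by
    rw [abs_mul]
    refine mul_le_mul hψ ((abs_sum_mul_spaceDeriv_le u w i (ξ + e)).trans ?_) (abs_nonneg _) hC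
    gcongr
    exact (norm_add_le ξ e).trans (by linarith)
  calc |parKernel u ψ z a e i l ξ|
      ≤ 2 * C * |timeDeriv u w| + C * (d * (2 * ‖spaceHess u w‖)) := by
        rw [parKernel, ← hw]
        exact (abs_add_le _ _).trans (add_le_add ((abs_neg _).trans_le htime) hspace)
    _ ≤ 2 * C * |timeDeriv u w| + C * (d * (2 * ‖spaceHess u w‖)) +
          (C * (2 * d) * |timeDeriv u w| + 2 * C * ‖spaceHess u w‖) :=
        le_add_of_nonneg_right (by positivity)
    _ = C * (2 + 2 * d) * heatSize u w := by ring

theorem parKernel_eq_zero {ξ : EuclideanSpace ℝ (Fin d)} (hξ : ξ ∉ tsupport ψ)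
    (z : SpaceTime d) (a : ℝ) (e : EuclideanSpace ℝ (Fin d)) (i : Fin d) (l : ℝ) :
    parKernel u ψ z a e i l ξ = 0 := by
  have hξ' : ξ ∉ tsupport (fderiv ℝ ψ) := fun h => hξ (tsupport_fderiv_subset ℝ h)
  simp [parKernel, image_eq_zero_of_notMem_tsupport hξ, image_eq_zero_of_notMem_tsupport hξ']

theorem exists_enorm_spaceDeriv_le_path (d : ℕ) : ∃ C : ℝ≥0, ∀ (u : SpaceTime d → ℝ)
    (_ : ContDiff ℝ 2 u) (z : SpaceTime d) (a : ℝ) (_ : |a| ≤ 1)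
    (e : EuclideanSpace ℝ (Fin d)) (_ : ‖e‖ ≤ 1) (L : ℝ) (_ : 0 < L) (i : Fin d),
    ‖spaceDeriv i u z‖ₑ ≤
      C * ((ENNReal.ofReal L)⁻¹ * ∫⁻ ξ in Metric.ball 0 1, ‖u (parPath z a e ξ L)‖ₑ) +
      C * ∫⁻ l in Set.Ioc 0 L, ∫⁻ ξ in Metric.ball 0 1, ‖heatSize u (parPath z a e ξ l)‖ₑ := by
  obtain ⟨ψ, C, hψ, hψc, hψs, hψ1, hC₀, hC₁⟩ := exists_bump d
  refine ⟨C * (2 + 2 * d), fun u hu z a ha e he L hL i => ?_⟩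
  have hCle : C ≤ C * (2 + 2 * d) :=
    le_mul_of_one_le_right zero_le (one_le_two.trans le_self_add)
  rw [spaceDeriv_eq_integral hu hψ hψc hψ1 z a e hL.ne' i]
  refine enorm_sub_le.trans (add_le_add ?_ ?_)
  · have hLinv : ‖L⁻¹‖ₑ = (ENNReal.ofReal L)⁻¹ := by
      rw [enorm_inv hL.ne', Real.enorm_of_nonneg hL.le]
    rw [enorm_neg, enorm_mul, mul_left_comm, hLinv]
    gcongr
    refine enorm_integral_le_mul_setLIntegral measurableSet_ball (fun ξ _ => ?_) fun ξ hξ => ?_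
    · rw [norm_mul]
      gcongr
      exact (abs_fderiv_single_le (hC₁ ξ) i).trans (by exact_mod_cast hCle)
    · have hξ' : ξ ∉ tsupport (fderiv ℝ ψ) := fun h => hξ (hψs (tsupport_fderiv_subset ℝ h))
      simp [image_eq_zero_of_notMem_tsupport hξ']
  · rw [intervalIntegral.integral_of_le hL.le, ← lintegral_const_mul' _ _ ENNReal.coe_ne_top]
    refine (enorm_integral_le_lintegral_enorm _).trans (lintegral_mono fun l => ?_)
    refine enorm_integral_le_mul_setLIntegral measurableSet_ball (fun ξ hξ => ?_)
      fun ξ hξ => parKernel_eq_zero (fun h => hξ (hψs h)) z a e i l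
    refine (abs_parKernel_le (hC₀ ξ) (hC₁ ξ) ha he (mem_ball_zero_iff.1 hξ).le z i l).trans ?_
    push_cast
    gcongr
    exact le_abs_self _

end PathBound

section Potentials

variable {d : ℕ} {u : SpaceTime d → ℝ} {g : SpaceTime d → ℝ≥0∞}

/-- The parabolic mean `l ^ (-d - 2) ∫ g` over the two-sided cylinder of radius `2 l`. It is
normalised by a power of `l` rather than by the volume of the cylinder. -/
def potAvg (g : SpaceTime d → ℝ≥0∞) (z : SpaceTime d) (l : ℝ) : ℝ≥0∞ :=
  (ENNReal.ofReal (l ^ (d + 2)))⁻¹ * ∫⁻ w in parBox z (2 * l), g w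

theorem lintegral_comp_add_smul {E : Type*} [NormedAddCommGroup E] [NormedSpace ℝ E]
    [FiniteDimensional ℝ E] [MeasurableSpace E] [BorelSpace E] (μ : Measure E)
    [μ.IsAddHaarMeasure] (c : E) {l : ℝ} (hl : 0 < l) {g : E → ℝ≥0∞} (hg : Measurable g) :
    ∫⁻ ξ, g (c + l • ξ) ∂μ = (ENNReal.ofReal (l ^ Module.finrank ℝ E))⁻¹ * ∫⁻ y, g y ∂μ := by
  have hmap : ∫⁻ ξ, g (c + l • ξ) ∂μ = ∫⁻ y, g (c + y) ∂(μ.map (l • ·)) := by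
    rw [lintegral_map (by fun_prop) (by fun_prop)]
  rw [hmap, Measure.map_addHaar_smul μ hl.ne', lintegral_smul_measure, lintegral_add_left_eq_self,
    abs_of_pos (by positivity), ENNReal.ofReal_inv_of_pos (by positivity), smul_eq_mul]

theorem parPath_mem_parBox (z : SpaceTime d) {a : ℝ} (ha : |a| < 4)
    {e ξ : EuclideanSpace ℝ (Fin d)} (he : ‖e‖ ≤ 1) (hξ : ‖ξ‖ < 1) {l : ℝ} (hl : 0 < l) :
    parPath z a e ξ l ∈ parBox z (2 * l) := by
  have hl2 : 0 < l ^ 2 := by positivity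
  constructor
  · rw [Metric.mem_ball, Real.dist_eq, parPath, add_sub_cancel_left, abs_mul, abs_of_pos hl2]
    nlinarith
  · rw [Metric.mem_ball, parPath, dist_self_add_left, norm_smul, Real.norm_of_nonneg hl.le]
    nlinarith [norm_add_le ξ e]

theorem lintegral_lintegral_parPath (hg : Measurable g) (z : SpaceTime d) (a : ℝ)
    (e : EuclideanSpace ℝ (Fin d)) {l : ℝ} (hl : 0 < l) :
    ∫⁻ τ : ℝ, ∫⁻ ξ, g (parPath z (τ + a) e ξ l) =
      (ENNReal.ofReal (l ^ (d + 2)))⁻¹ * ∫⁻ w, g w := by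
  have hinner (τ : ℝ) : ∫⁻ ξ, g (parPath z (τ + a) e ξ l) =
      (ENNReal.ofReal (l ^ d))⁻¹ * ∫⁻ y, g (z.1 + l ^ 2 * (τ + a), y) := by
    have hscale := lintegral_comp_add_smul (volume : Measure (EuclideanSpace ℝ (Fin d)))
      (z.2 + l • e) hl (hg.comp (measurable_prodMk_left (x := z.1 + l ^ 2 * (τ + a))))
    rw [finrank_euclideanSpace_fin] at hscale
    simp only [parPath, smul_add, ← add_assoc, add_right_comm z.2 _ (l • e)]
    exact hscale
  have houter : ∫⁻ τ : ℝ, ∫⁻ y, g (z.1 + l ^ 2 * (τ + a), y) =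
      (ENNReal.ofReal (l ^ 2))⁻¹ * ∫⁻ s : ℝ, ∫⁻ y, g (s, y) := by
    have hscale := lintegral_comp_add_smul (volume : Measure ℝ) (z.1 + l ^ 2 * a)
      (pow_pos hl 2) (hg.lintegral_prod_right' (ν := volume))
    rw [Module.finrank_self, pow_one] at hscale
    simp only [mul_add, ← add_assoc, add_right_comm z.1 _ (l ^ 2 * a)]
    exact hscale
  have hl0 : ENNReal.ofReal (l ^ d) ≠ 0 := (ENNReal.ofReal_pos.2 (by positivity)).ne'
  rw [lintegral_congr hinner, lintegral_const_mul' _ _ (ENNReal.inv_ne_top.2 hl0), houter,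
    lintegral_volume_prod hg, ← mul_assoc, pow_add, ENNReal.ofReal_mul (by positivity),
    ENNReal.mul_inv (Or.inr ENNReal.ofReal_ne_top) (Or.inl ENNReal.ofReal_ne_top)]

theorem lintegral_parPath_le (hg : Measurable g) (z : SpaceTime d) {a : ℝ} (ha : |a| ≤ 1)
    {e : EuclideanSpace ℝ (Fin d)} (he : ‖e‖ ≤ 1) {l : ℝ} (hl : 0 < l) :
    ∫⁻ τ in Set.Ioo (0 : ℝ) 1, ∫⁻ ξ in Metric.ball 0 1, g (parPath z (τ + a) e ξ l) ≤
      potAvg g z l := by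
  have hbox := measurableSet_parBox z (2 * l)
  calc ∫⁻ τ in Set.Ioo (0 : ℝ) 1, ∫⁻ ξ in Metric.ball 0 1, g (parPath z (τ + a) e ξ l)
      ≤ ∫⁻ τ in Set.Ioo (0 : ℝ) 1, ∫⁻ ξ in Metric.ball 0 1,
          (parBox z (2 * l)).indicator g (parPath z (τ + a) e ξ l) := by
        refine setLIntegral_mono' measurableSet_Ioo fun τ hτ => ?_
        refine setLIntegral_mono' measurableSet_ball fun ξ hξ => ?_
        have hτa : |τ + a| < 4 := by
          rw [abs_le] at ha
          rw [abs_lt]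
          constructor <;> linarith [hτ.1, hτ.2]
        rw [Set.indicator_of_mem (parPath_mem_parBox z hτa he (mem_ball_zero_iff.1 hξ) hl)]
    _ ≤ ∫⁻ τ : ℝ, ∫⁻ ξ, (parBox z (2 * l)).indicator g (parPath z (τ + a) e ξ l) :=
        (setLIntegral_le_lintegral _ _).trans
          (lintegral_mono fun τ => setLIntegral_le_lintegral _ _)
    _ = potAvg g z l := by
        rw [lintegral_lintegral_parPath (hg.indicator hbox) z a e hl, lintegral_indicator hbox,
          potAvg]

theorem measurable_lintegral_parPath (hg : Measurable g) (z : SpaceTime d) (a : ℝ)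
    (e : EuclideanSpace ℝ (Fin d)) : Measurable fun p : ℝ × ℝ =>
      ∫⁻ ξ in Metric.ball 0 1, g (parPath z (p.1 + a) e ξ p.2) := by
  have hpath : Measurable fun p : (ℝ × ℝ) × EuclideanSpace ℝ (Fin d) =>
      parPath z (p.1.1 + a) e p.2 p.1.2 := by
    unfold parPath
    fun_prop
  exact (hg.comp hpath).lintegral_prod_right'

theorem lintegral_lintegral_Ioc_parPath_le (hg : Measurable g) (z : SpaceTime d) {a : ℝ}
    (ha : |a| ≤ 1) {e : EuclideanSpace ℝ (Fin d)} (he : ‖e‖ ≤ 1) (L : ℝ) :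
    ∫⁻ τ in Set.Ioo (0 : ℝ) 1, ∫⁻ l in Set.Ioc 0 L, ∫⁻ ξ in Metric.ball 0 1,
        g (parPath z (τ + a) e ξ l) ≤ ∫⁻ l in Set.Ioc 0 L, potAvg g z l := by
  rw [lintegral_lintegral_swap (measurable_lintegral_parPath hg z a e).aemeasurable]
  exact setLIntegral_mono' measurableSet_Ioc fun l hl => lintegral_parPath_le hg z ha he hl.1

theorem exists_enorm_spaceDeriv_le_potAvg (d : ℕ) : ∃ C : ℝ≥0, ∀ (u : SpaceTime d → ℝ)
    (_ : ContDiff ℝ 2 u) (Q : Set (SpaceTime d)) (_ : MeasurableSet Q) (z : SpaceTime d)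
    (a : ℝ) (_ : -1 ≤ a) (_ : a ≤ 0) (e : EuclideanSpace ℝ (Fin d)) (_ : ‖e‖ ≤ 1) (L : ℝ)
    (_ : 0 < L) (_ : ∀ l ∈ Set.Ioc 0 L, ∀ τ ∈ Set.Ioo (0 : ℝ) 1,
      ∀ ξ ∈ Metric.ball (0 : EuclideanSpace ℝ (Fin d)) 1, parPath z (τ + a) e ξ l ∈ Q) (i : Fin d),
    ‖spaceDeriv i u z‖ₑ ≤
      C * ((ENNReal.ofReal L)⁻¹ * potAvg (Q.indicator fun w => ‖u w‖ₑ) z L) +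
      C * ∫⁻ l in Set.Ioc 0 L, potAvg (Q.indicator fun w => ‖heatSize u w‖ₑ) z l := by
  obtain ⟨C, hC⟩ := exists_enorm_spaceDeriv_le_path d
  refine ⟨C, fun u hu Q hQ z a ha1 ha0 e he L hL hpath i => ?_⟩
  have ha : |a| ≤ 1 := abs_le.2 ⟨ha1, by linarith⟩
  have hUm : Measurable (Q.indicator fun w => ‖u w‖ₑ) :=
    hu.continuous.enorm.measurable.indicator hQ
  have hFm : Measurable (Q.indicator fun w => ‖heatSize u w‖ₑ) :=
    (continuous_heatSize hu).enorm.measurable.indicator hQ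
  set U := Q.indicator fun w => ‖u w‖ₑ with hU
  set F := Q.indicator fun w => ‖heatSize u w‖ₑ with hF
  have hτ : ∀ τ ∈ Set.Ioo (0 : ℝ) 1, ‖spaceDeriv i u z‖ₑ ≤
      C * ((ENNReal.ofReal L)⁻¹ * ∫⁻ ξ in Metric.ball 0 1, U (parPath z (τ + a) e ξ L)) +
      C * ∫⁻ l in Set.Ioc 0 L, ∫⁻ ξ in Metric.ball 0 1, F (parPath z (τ + a) e ξ l) := by
    intro τ hτ
    have hτa : |τ + a| ≤ 1 := abs_le.2 ⟨by linarith [hτ.1], by linarith [hτ.2]⟩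
    refine (hC u hu z (τ + a) hτa e he L hL i).trans ?_
    gcongr C * (_ * ?_) + C * ?_
    · refine setLIntegral_mono' measurableSet_ball fun ξ hξ => ?_
      rw [hU, Set.indicator_of_mem (hpath L ⟨hL, le_rfl⟩ τ hτ ξ hξ)]
    · refine setLIntegral_mono' measurableSet_Ioc fun l hl => ?_
      refine setLIntegral_mono' measurableSet_ball fun ξ hξ => ?_
      rw [hF, Set.indicator_of_mem (hpath l hl τ hτ ξ hξ)]
  have hmU : Measurable fun τ : ℝ => ∫⁻ ξ in Metric.ball 0 1, U (parPath z (τ + a) e ξ L) :=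
    (measurable_lintegral_parPath hUm z a e).comp (measurable_prodMk_right (y := L))
  calc ‖spaceDeriv i u z‖ₑ = ∫⁻ _ in Set.Ioo (0 : ℝ) 1, ‖spaceDeriv i u z‖ₑ := by simp
    _ ≤ ∫⁻ τ in Set.Ioo (0 : ℝ) 1, _ := setLIntegral_mono' measurableSet_Ioo hτ
    _ ≤ _ := by
        rw [lintegral_add_left ((hmU.const_mul _).const_mul _),
          lintegral_const_mul _ (hmU.const_mul _), lintegral_const_mul _ hmU,
          lintegral_const_mul' _ _ ENNReal.coe_ne_top]
        gcongr C * (_ * ?_) + C * ?_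
        · exact lintegral_parPath_le hUm z ha he hL
        · exact lintegral_lintegral_Ioc_parPath_le hFm z ha he L

end Potentials

section ParabolicMaximal

variable {d : ℕ}

/-- The dyadic system of two-sided parabolic cylinders: a time interval of half-length `4 ^ k`
times a space ball of radius `2 ^ k`. -/
def parBall : SpaceTime d → ℤ → Set (SpaceTime d) :=
  prodBall (fun t k => Metric.ball t (4 ^ k)) (fun x k => Metric.ball x (2 ^ k))

/-- The parabolic Hardy–Littlewood maximal function. -/
def parMax (g : SpaceTime d → ℝ≥0∞) : SpaceTime d → ℝ≥0∞ := maximalFn volume parBall g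

theorem measurable_parMax {g : SpaceTime d → ℝ≥0∞} (hg : Measurable g) :
    Measurable (parMax g) :=
  ((isBallSystem_ball (by norm_num)).prod (isBallSystem_ball le_rfl)).measurable_maximalFn
    (μ := volume) hg

theorem exists_lmixed_parMax_le (d : ℕ) {p q : ℝ} (hp : 1 < p) (hq : 1 < q) :
    ∃ C : ℝ≥0∞, C ≠ ⊤ ∧ ∀ g : SpaceTime d → ℝ≥0∞, Measurable g →
      lmixed p q (parMax g) ≤ C * lmixed p q g :=
  exists_lmixed_maximalFn_le (isDoublingBallSystem_ball volume (by norm_num))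
    (isDoublingBallSystem_ball volume le_rfl) ENNReal.ofReal_ne_top ENNReal.ofReal_ne_top hp hq

theorem parMax_le_of_le {g : SpaceTime d → ℝ≥0∞} {c : ℝ≥0∞} (hg : ∀ w, g w ≤ c)
    (z : SpaceTime d) : parMax g z ≤ c :=
  (iSup_mono fun k => setLAverage_mono (parBall z k) hg).trans (maximalFn_const_le c z)

theorem parBall_eq_parBox (z : SpaceTime d) (k : ℤ) : parBall z k = parBox z (2 ^ k) := by
  have hsq : (4 : ℝ) ^ k = (2 ^ k) ^ 2 := by
    rw [← zpow_natCast, zpow_comm]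
    norm_num
  rw [parBall, prodBall, parBox, hsq]

theorem volume_parBox (z : SpaceTime d) {r : ℝ} (hr : 0 < r) :
    volume (parBox z r) = ENNReal.ofReal (2 * r ^ (d + 2)) * unitVol d := by
  rw [parBox, Measure.volume_eq_prod, Measure.prod_prod, Real.volume_ball,
    Measure.addHaar_ball_of_pos _ _ hr, finrank_euclideanSpace_fin, ← mul_assoc,
    ← ENNReal.ofReal_mul (by positivity), unitVol, pow_add]
  ring_nf

/-- The constant bounding parabolic means at all scales by the dyadic maximal function. -/
def parMaxConst (d : ℕ) : ℝ≥0∞ := ENNReal.ofReal (2 * 4 ^ (d + 2)) * unitVol d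

theorem parMaxConst_ne_top (d : ℕ) : parMaxConst d ≠ ⊤ :=
  ENNReal.mul_ne_top ENNReal.ofReal_ne_top unitVol_ne_top

theorem potAvg_le_parMax (g : SpaceTime d → ℝ≥0∞) (z : SpaceTime d) {l : ℝ} (hl : 0 < l) :
    potAvg g z l ≤ parMaxConst d * parMax g z := by
  obtain ⟨n, hn, hn'⟩ := exists_mem_Ioc_zpow (mul_pos two_pos hl) one_lt_two
  have hr0 : (0 : ℝ) < 2 ^ (n + 1) := by positivity
  have hr : (2 : ℝ) ^ (n + 1) ≤ 4 * l := by
    rw [zpow_add_one₀ two_ne_zero]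
    linarith
  have hsub : parBox z (2 * l) ⊆ parBall z (n + 1) := by
    rw [parBall_eq_parBox]
    exact Set.prod_mono (Metric.ball_subset_ball (by gcongr)) (Metric.ball_subset_ball hn')
  have hvol : volume (parBall z (n + 1)) ≤ ENNReal.ofReal (l ^ (d + 2)) * parMaxConst d := by
    rw [parBall_eq_parBox, volume_parBox z hr0, parMaxConst, ← mul_assoc,
      ← ENNReal.ofReal_mul (by positivity), mul_left_comm, ← mul_pow, mul_comm l]
    gcongr
  have hvol_top : volume (parBall z (n + 1)) ≠ ⊤ :=
    (hvol.trans_lt (ENNReal.mul_lt_top ENNReal.ofReal_lt_top (parMaxConst_ne_top d).lt_top)).ne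
  have hl0 : ENNReal.ofReal (l ^ (d + 2)) ≠ 0 := (ENNReal.ofReal_pos.2 (by positivity)).ne'
  calc potAvg g z l ≤ (ENNReal.ofReal (l ^ (d + 2)))⁻¹ * ∫⁻ w in parBall z (n + 1), g w := by
        unfold potAvg
        gcongr
    _ = (ENNReal.ofReal (l ^ (d + 2)))⁻¹ *
          (volume (parBall z (n + 1)) * ⨍⁻ w in parBall z (n + 1), g w ∂volume) := by
        rw [measure_mul_setLAverage g hvol_top]
    _ ≤ (ENNReal.ofReal (l ^ (d + 2)))⁻¹ *
          (ENNReal.ofReal (l ^ (d + 2)) * parMaxConst d * parMax g z) := by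
        gcongr
        exact setLAverage_le_maximalFn z (n + 1)
    _ = parMaxConst d * parMax g z := by
        rw [mul_assoc, ← mul_assoc, ENNReal.inv_mul_cancel hl0 ENNReal.ofReal_ne_top, one_mul]

end ParabolicMaximal

section ParabolicPotential

variable {d : ℕ} {p q β : ℝ} {f : SpaceTime d → ℝ≥0∞}

/-- The constant bounding parabolic means by the Morrey norm. -/
def potConst (d : ℕ) (β : ℝ) : ℝ≥0∞ := 4 ^ (d + 2 - β) * unitVol d

theorem potConst_ne_top (d : ℕ) (β : ℝ) : potConst d β ≠ ⊤ :=
  ENNReal.mul_ne_top (ENNReal.rpow_ne_top_of_ne_zero (by simp) (by simp)) unitVol_ne_top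

theorem potAvg_le_lmorrey (hp : 1 ≤ p) (hq : 1 ≤ q) (β : ℝ) (R : ℝ≥0∞) (hf : Measurable f)
    {z : SpaceTime d} (hz : z ∈ cylinder R 0) {l : ℝ} (hl : 0 < l) :
    potAvg ((cylinder R 0).indicator f) z l ≤
      potConst d β * lmorrey p q β (cylinder R 0) f * ENNReal.ofReal l ^ (-β) := by
  lift l to ℝ≥0 using hl.le
  have hl' : 0 < l := NNReal.coe_pos.1 hl
  have hl0 : (l : ℝ≥0∞) ≠ 0 := ENNReal.coe_ne_zero.2 hl'.ne'
  have hbox := setLIntegral_parBox_le_lmorrey hp hq β R hf (mul_pos two_pos hl') hz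
  have hinv : ((l : ℝ≥0∞) ^ (d + 2))⁻¹ = (l : ℝ≥0∞) ^ (-((d : ℝ) + 2)) := by
    rw [ENNReal.rpow_neg, ← ENNReal.rpow_natCast]
    norm_cast
  have hfour : ((2 * (2 * l) : ℝ≥0) : ℝ≥0∞) ^ ((d : ℝ) + 2 - β) =
      4 ^ ((d : ℝ) + 2 - β) * (l : ℝ≥0∞) ^ ((d : ℝ) + 2 - β) := by
    rw [← mul_assoc, ENNReal.coe_mul, ENNReal.mul_rpow_of_ne_top ENNReal.coe_ne_top
      ENNReal.coe_ne_top]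
    norm_num
  have hsplit : (l : ℝ≥0∞) ^ (-β) =
      (l : ℝ≥0∞) ^ (-((d : ℝ) + 2)) * (l : ℝ≥0∞) ^ ((d : ℝ) + 2 - β) := by
    rw [← ENNReal.rpow_add _ _ hl0 ENNReal.coe_ne_top]
    ring_nf
  rw [potAvg, ENNReal.ofReal_pow hl.le, ENNReal.ofReal_coe_nnreal]
  refine (mul_le_mul' le_rfl hbox).trans_eq ?_
  rw [hinv, hfour, hsplit, potConst]
  ring

/-- The parabolic Riesz potential of order one, written as an integral of means over scales. -/
def parPotential (g : SpaceTime d → ℝ≥0∞) (z : SpaceTime d) : ℝ≥0∞ :=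
  ∫⁻ l in Set.Ioi (0 : ℝ), potAvg g z l

theorem setLIntegral_Ioc_potAvg_le (g : SpaceTime d → ℝ≥0∞) (z : SpaceTime d) (L : ℝ) :
    ∫⁻ l in Set.Ioc 0 L, potAvg g z l ≤ parPotential g z :=
  lintegral_mono_set Set.Ioc_subset_Ioi_self

theorem le_of_forall_le_inv_ofReal_mul_add {a b K : ℝ≥0∞} (hK : K ≠ ⊤)
    (h : ∀ L : ℝ, 0 < L → a ≤ (ENNReal.ofReal L)⁻¹ * K + b) : a ≤ b := by
  have hinv : Filter.Tendsto (fun L : ℝ => (ENNReal.ofReal L)⁻¹) Filter.atTop (nhds 0) := by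
    rw [← ENNReal.inv_top]
    exact tendsto_inv_iff.2 ENNReal.tendsto_ofReal_atTop
  have hlim := (ENNReal.Tendsto.mul_const hinv (Or.inr hK)).add_const b
  rw [zero_mul, zero_add] at hlim
  exact ge_of_tendsto hlim ((Filter.eventually_gt_atTop 0).mono h)

theorem exists_enorm_spaceDeriv_le_parPotential_top (d : ℕ) : ∃ C : ℝ≥0, ∀ u : SpaceTime d → ℝ,
    ContDiff ℝ 2 u → ∀ B : ℝ, (∀ w, ‖u w‖ ≤ B) → ∀ z ∈ cylinder ⊤ 0, ∀ i,
      ‖spaceDeriv i u z‖ₑ ≤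
        C * parPotential ((cylinder ⊤ 0).indicator fun w => ‖heatSize u w‖ₑ) z := by
  obtain ⟨C, hC⟩ := exists_enorm_spaceDeriv_le_potAvg d
  refine ⟨C, fun u hu B hB z hz i => ?_⟩
  set P := parPotential ((cylinder ⊤ 0).indicator fun w => ‖heatSize u w‖ₑ) z
  have hQ := measurableSet_cylinder (d := d) ⊤ 0
  have hz1 : 0 ≤ z.1 := (mem_cylinder_top 0 z).1 hz
  set K : ℝ≥0∞ := parMaxConst d * ENNReal.ofReal B
  have hK : K ≠ ⊤ := ENNReal.mul_ne_top (parMaxConst_ne_top d) ENNReal.ofReal_ne_top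
  have hmean (L : ℝ) (hL : 0 < L) :
      potAvg ((cylinder ⊤ 0).indicator fun w => ‖u w‖ₑ) z L ≤ K := by
    refine (potAvg_le_parMax _ z hL).trans (mul_le_mul' le_rfl (parMax_le_of_le (fun w => ?_) z))
    refine (Set.indicator_le_self _ _ w).trans ?_
    rw [← ofReal_norm]
    exact ENNReal.ofReal_le_ofReal (hB w)
  have hscale (L : ℝ) (hL : 0 < L) :
      ‖spaceDeriv i u z‖ₑ ≤ C * ((ENNReal.ofReal L)⁻¹ * K) + C * P := by
    have hpath : ∀ l ∈ Set.Ioc 0 L, ∀ τ ∈ Set.Ioo (0 : ℝ) 1,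
        ∀ ξ ∈ Metric.ball (0 : EuclideanSpace ℝ (Fin d)) 1,
          parPath z (τ + 0) 0 ξ l ∈ cylinder ⊤ 0 := by
      intro l _ τ hτ ξ _
      rw [mem_cylinder_top, parPath, add_zero]
      have hτ0 := hτ.1.le
      exact add_nonneg hz1 (by positivity)
    refine (hC u hu _ hQ z 0 (by norm_num) le_rfl 0 (by simp) L hL hpath i).trans ?_
    gcongr
    · exact hmean L hL
    · exact setLIntegral_Ioc_potAvg_le _ z L
  refine le_of_forall_le_inv_ofReal_mul_add (ENNReal.mul_ne_top (a := C) ENNReal.coe_ne_top hK)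
    fun L hL => (hscale L hL).trans_eq ?_
  ring

-- This drift makes the path from `z` reach `(R ^ 2 * τ, R • ξ)` at `l = R`, so its coordinates are
-- convex combinations of coordinates of points of the cylinder.
theorem parPath_mem_cylinder {R : ℝ≥0} (hR : 0 < R) {z : SpaceTime d}
    (hz : z ∈ cylinder (R : ℝ≥0∞) 0) {l : ℝ} (hl : 0 < l) (hlR : l < R) {τ : ℝ}
    (hτ : τ ∈ Set.Ioo (0 : ℝ) 1) {ξ : EuclideanSpace ℝ (Fin d)} (hξ : ‖ξ‖ < 1) :
    parPath z (τ + -(z.1 / (R : ℝ) ^ 2)) (-((R : ℝ)⁻¹ • z.2)) ξ l ∈ cylinder (R : ℝ≥0∞) 0 := by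
  have hR' : (0 : ℝ) < R := NNReal.coe_pos.2 hR
  obtain ⟨hspace, htime, htime'⟩ := (mem_cylinder_coe R 0 z).1 hz
  simp only [Prod.fst_zero, Prod.snd_zero, zero_add, dist_zero_left] at hspace htime htime'
  have hθ : 0 < 1 - l / R := sub_pos.2 ((div_lt_one hR').2 hlR)
  have hθ2 : 0 < 1 - l ^ 2 / (R : ℝ) ^ 2 := sub_pos.2 ((div_lt_one (by positivity)).2 (by gcongr))
  have hfst : z.1 + l ^ 2 * (τ + -(z.1 / (R : ℝ) ^ 2)) =
      (1 - l ^ 2 / (R : ℝ) ^ 2) * z.1 + l ^ 2 * τ := by ring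
  have hsnd : z.2 + l • (ξ + -((R : ℝ)⁻¹ • z.2)) = (1 - l / R) • z.2 + l • ξ := by
    module
  rw [mem_cylinder_coe]
  simp only [parPath, Prod.fst_zero, Prod.snd_zero, zero_add, dist_zero_left]
  rw [hfst, hsnd]
  have hτ0 := hτ.1
  refine ⟨?_, by positivity, ?_⟩
  · calc ‖(1 - l / R) • z.2 + l • ξ‖ ≤ (1 - l / R) * ‖z.2‖ + l * ‖ξ‖ := by
          refine (norm_add_le _ _).trans_eq ?_
          rw [norm_smul, norm_smul, Real.norm_of_nonneg hθ.le, Real.norm_of_nonneg hl.le]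
      _ < (1 - l / R) * R + l * 1 := by gcongr
      _ = R := by field_simp; ring
  · calc (1 - l ^ 2 / (R : ℝ) ^ 2) * z.1 + l ^ 2 * τ
        < (1 - l ^ 2 / (R : ℝ) ^ 2) * (R : ℝ) ^ 2 + l ^ 2 * 1 := by gcongr; exact hτ.2
      _ = (R : ℝ) ^ 2 := by field_simp; ring

theorem exists_enorm_spaceDeriv_le_parPotential_coe (d : ℕ) : ∃ C : ℝ≥0, ∀ u : SpaceTime d → ℝ,
    ContDiff ℝ 2 u → ∀ R : ℝ≥0, 0 < R → ∀ z ∈ cylinder (R : ℝ≥0∞) 0, ∀ i,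
      ‖spaceDeriv i u z‖ₑ ≤
        C * parPotential ((cylinder R 0).indicator fun w => ‖heatSize u w‖ₑ) z +
        C * ((ENNReal.ofReal (R / 2))⁻¹ *
          potAvg ((cylinder R 0).indicator fun w => ‖u w‖ₑ) z (R / 2)) := by
  obtain ⟨C, hC⟩ := exists_enorm_spaceDeriv_le_potAvg d
  refine ⟨C, fun u hu R hR z hz i => ?_⟩
  have hR' : (0 : ℝ) < R := NNReal.coe_pos.2 hR
  obtain ⟨hspace, htime, htime'⟩ := (mem_cylinder_coe R 0 z).1 hz
  simp only [Prod.fst_zero, Prod.snd_zero, zero_add, dist_zero_left] at hspace htime htime'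
  have ha : -1 ≤ -(z.1 / (R : ℝ) ^ 2) := by
    rw [neg_le_neg_iff, div_le_one (by positivity)]
    exact htime'.le
  have he : ‖-((R : ℝ)⁻¹ • z.2)‖ ≤ 1 := by
    rw [norm_neg, norm_smul, Real.norm_of_nonneg (by positivity), inv_mul_le_one₀ hR']
    exact hspace.le
  refine (hC u hu _ (measurableSet_cylinder R 0) z _ ha (neg_nonpos.2 (by positivity)) _ he
    (R / 2) (half_pos hR') (fun l hl τ hτ ξ hξ => parPath_mem_cylinder hR hz hl.1
      (by linarith [hl.2]) hτ (mem_ball_zero_iff.1 hξ)) i).trans ?_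
  rw [add_comm]
  gcongr
  exact setLIntegral_Ioc_potAvg_le _ z _

theorem inv_half_mul_potAvg_half_le (hp : 1 ≤ p) (hq : 1 ≤ q) (hβ : 0 ≤ 1 + β) {R : ℝ≥0}
    (hR : 0 < R) (hf : Measurable f) {z : SpaceTime d} (hz : z ∈ cylinder (R : ℝ≥0∞) 0) :
    (ENNReal.ofReal (R / 2))⁻¹ * potAvg ((cylinder R 0).indicator f) z (R / 2) ≤
      2 ^ (1 + β) * potConst d β *
        (((R : ℝ≥0∞) ^ (1 + β))⁻¹ * lmorrey p q β (cylinder R 0) f) := by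
  have hhalf : (0 : ℝ) < R / 2 := half_pos (NNReal.coe_pos.2 hR)
  set h := ENNReal.ofReal (R / 2) with hh
  have hh0 : h ≠ 0 := (ENNReal.ofReal_pos.2 hhalf).ne'
  have hdouble : (R : ℝ≥0∞) = 2 * h := by
    rw [hh, ← ENNReal.ofReal_ofNat, ← ENNReal.ofReal_mul zero_le_two, mul_div_cancel₀ _ two_ne_zero,
      ENNReal.ofReal_coe_nnreal]
  have hpow : h⁻¹ * h ^ (-β) = 2 ^ (1 + β) * ((R : ℝ≥0∞) ^ (1 + β))⁻¹ := by
    rw [hdouble, ENNReal.mul_rpow_of_nonneg _ _ hβ, ENNReal.mul_inv (by simp) (by simp),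
      ← mul_assoc, ENNReal.mul_inv_cancel (by simp) (by simp), one_mul, ← ENNReal.rpow_neg_one,
      ← ENNReal.rpow_add _ _ hh0 ENNReal.ofReal_ne_top, ← ENNReal.rpow_neg, neg_add]
  calc h⁻¹ * potAvg ((cylinder R 0).indicator f) z (R / 2)
      ≤ h⁻¹ * (potConst d β * lmorrey p q β (cylinder R 0) f * h ^ (-β)) := by
        gcongr
        exact potAvg_le_lmorrey hp hq β R hf hz hhalf
    _ = potConst d β * lmorrey p q β (cylinder R 0) f * (h⁻¹ * h ^ (-β)) := mul_left_comm _ _ _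
    _ = _ := by rw [hpow]; ring

theorem enorm_spaceGrad_le (u : SpaceTime d → ℝ) (z : SpaceTime d) :
    ‖spaceGrad u z‖ₑ ≤ ∑ i, ‖spaceDeriv i u z‖ₑ := by
  rw [← (EuclideanSpace.basisFun (Fin d) ℝ).sum_repr (spaceGrad u z)]
  refine (enorm_sum_le _ _).trans (Finset.sum_le_sum fun i _ => ?_)
  rw [enorm_smul]
  simp [spaceGrad, enorm_eq_nnnorm]

theorem exists_enorm_spaceGrad_le_parPotential (d : ℕ) (hp : 1 ≤ p) (hq : 1 ≤ q)
    (hβ : 0 ≤ 1 + β) : ∃ C C' : ℝ≥0∞, C ≠ ⊤ ∧ C' ≠ ⊤ ∧ ∀ R : ℝ≥0∞, 0 < R →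
      ∀ u : SpaceTime d → ℝ, ContDiff ℝ 2 u → (R = ⊤ → ∃ B : ℝ, ∀ w, ‖u w‖ ≤ B) →
        ∀ z ∈ cylinder R 0, ‖spaceGrad u z‖ₑ ≤
          C * parPotential ((cylinder R 0).indicator fun w => ‖heatSize u w‖ₑ) z +
            C' * ((R ^ (1 + β))⁻¹ * lmorrey p q β (cylinder R 0) fun w => ‖u w‖ₑ) := by
  obtain ⟨C₁, h₁⟩ := exists_enorm_spaceDeriv_le_parPotential_top d
  obtain ⟨C₂, h₂⟩ := exists_enorm_spaceDeriv_le_parPotential_coe d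
  have hpot := potConst_ne_top d β
  refine ⟨d * (C₁ + C₂), d * (C₂ * (2 ^ (1 + β) * potConst d β)), by finiteness, by finiteness,
    fun R hR u hu hbdd z hz => ?_⟩
  set P := parPotential ((cylinder R 0).indicator fun w => ‖heatSize u w‖ₑ) z
  set Φ := lmorrey p q β (cylinder R 0) fun w => ‖u w‖ₑ
  have hderiv (i : Fin d) : ‖spaceDeriv i u z‖ₑ ≤ (C₁ + C₂) * P +
      C₂ * (2 ^ (1 + β) * potConst d β) * ((R ^ (1 + β))⁻¹ * Φ) := by
    induction R with
    | top =>
      obtain ⟨B, hB⟩ := hbdd rfl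
      refine (h₁ u hu B hB z hz i).trans (le_add_right ?_)
      gcongr
      exact le_self_add
    | coe R =>
      have hR0 : 0 < R := ENNReal.coe_pos.1 hR
      refine (h₂ u hu R hR0 z hz i).trans ?_
      rw [mul_assoc (C₂ : ℝ≥0∞)]
      gcongr ?_ * _ + C₂ * ?_
      · exact le_add_self
      · exact inv_half_mul_potAvg_half_le hp hq hβ hR0 hu.continuous.enorm.measurable hz
  calc ‖spaceGrad u z‖ₑ ≤ ∑ i, ‖spaceDeriv i u z‖ₑ := enorm_spaceGrad_le u z
    _ ≤ _ := Finset.sum_le_card_nsmul _ _ _ fun i _ => hderiv i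
    _ = _ := by
        rw [Finset.card_univ, Fintype.card_fin, nsmul_eq_mul]
        ring

end ParabolicPotential

section Adams

variable {d : ℕ} {p q q₁ q₂ r₁ r₂ β : ℝ} {f g : SpaceTime d → ℝ≥0∞}

theorem measurable_potAvg (hg : Measurable g) :
    Measurable fun a : SpaceTime d × ℝ => potAvg g a.1 a.2 := by
  have hset : MeasurableSet
      {a : (SpaceTime d × ℝ) × SpaceTime d | a.2 ∈ parBox a.1.1 (2 * a.1.2)} :=
    (measurableSet_lt (measurable_snd.fst.dist measurable_fst.fst.fst) (by fun_prop)).inter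
      (measurableSet_lt (measurable_snd.snd.dist measurable_fst.fst.snd) (by fun_prop))
  simp_rw [potAvg, ← lintegral_indicator (measurableSet_parBox _ _)]
  refine Measurable.mul (by fun_prop) ?_
  exact ((hg.comp measurable_snd).indicator hset).lintegral_prod_right'

theorem measurable_parPotential (hg : Measurable g) : Measurable (parPotential g) :=
  (measurable_potAvg hg).lintegral_prod_right'

theorem potAvg_indicator_parBox {z₀ z : SpaceTime d} {ρ : ℝ≥0}
    (hz : z ∈ cylinder (ρ : ℝ≥0∞) z₀) {l : ℝ} (hl : 0 < l) (hlρ : l ≤ ρ) :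
    potAvg ((parBox z₀ (3 * ρ)).indicator g) z l = potAvg g z l := by
  rw [potAvg, potAvg, setLIntegral_congr_fun (measurableSet_parBox _ _) fun w hw =>
    Set.indicator_of_mem (parBox_subset_parBox hz hl hlρ hw) g]

theorem parPotential_le (hp : 1 ≤ p) (hq : 1 ≤ q) (hβ : 1 < β) (R : ℝ≥0∞) (hf : Measurable f)
    {ρ : ℝ≥0} (hρ : 0 < ρ) {z₀ z : SpaceTime d} (hz : z ∈ cylinder R 0)
    (hzρ : z ∈ cylinder (ρ : ℝ≥0∞) z₀) :
    parPotential ((cylinder R 0).indicator f) z ≤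
      ENNReal.ofReal (1 + 1 / (β - 1)) * ((parMaxConst d *
        parMax ((parBox z₀ (3 * ρ)).indicator ((cylinder R 0).indicator f)) z) ^ (1 - 1 / β) *
          (potConst d β * lmorrey p q β (cylinder R 0) f) ^ (1 / β)) +
      potConst d β * lmorrey p q β (cylinder R 0) f *
        (ENNReal.ofReal (1 / (β - 1)) * (ρ : ℝ≥0∞) ^ (-(β - 1))) := by
  have hρ' : (0 : ℝ) < ρ := NNReal.coe_pos.2 hρ
  have hfar : ENNReal.ofReal (1 / (β - 1)) * (ρ : ℝ≥0∞) ^ (-(β - 1)) =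
      ENNReal.ofReal ((ρ : ℝ) ^ (1 - β) / (β - 1)) := by
    rw [div_eq_mul_one_div (_ ^ _), ENNReal.ofReal_mul (by positivity),
      ← ENNReal.ofReal_rpow_of_pos hρ', ENNReal.ofReal_coe_nnreal, neg_sub, mul_comm]
  set g := (cylinder R 0).indicator f
  have hmorrey (l : ℝ) (hl : 0 < l) : potAvg g z l ≤
      potConst d β * lmorrey p q β (cylinder R 0) f * ENNReal.ofReal l ^ (-β) :=
    potAvg_le_lmorrey hp hq β R hf hz hl
  have hmax (l : ℝ) (hl : 0 < l) : (Set.Ioc 0 (ρ : ℝ)).indicator (potAvg g z) l ≤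
      parMaxConst d * parMax ((parBox z₀ (3 * ρ)).indicator g) z := by
    rcases em (l ∈ Set.Ioc 0 (ρ : ℝ)) with hlρ | hlρ
    swap
    · exact (Set.indicator_of_notMem hlρ _).trans_le zero_le
    rw [Set.indicator_of_mem hlρ]
    rw [← potAvg_indicator_parBox hzρ hl hlρ.2]
    exact potAvg_le_parMax _ z hl
  have hnear : ∫⁻ l in Set.Ioc 0 (ρ : ℝ), potAvg g z l =
      ∫⁻ l in Set.Ioi (0 : ℝ), (Set.Ioc 0 (ρ : ℝ)).indicator (potAvg g z) l := by
    rw [setLIntegral_indicator measurableSet_Ioc, Set.inter_eq_left.2 Set.Ioc_subset_Ioi_self]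
  rw [parPotential, ← Set.Ioc_union_Ioi_eq_Ioi hρ'.le]
  refine (lintegral_union_le _ _ _).trans (add_le_add ?_ ?_)
  · rw [hnear]
    exact lintegral_Ioi_le_of_le_of_le hβ hmax fun l hl =>
      (Set.indicator_le_self _ _ l).trans (hmorrey l hl)
  · exact hfar ▸ setLIntegral_Ioi_le_of_le_rpow_neg hβ hmorrey hρ'

theorem lmixed_parBox_three_mul_le (hp : 0 < p) (hq : 0 < q) (β : ℝ) (R : ℝ≥0∞) {ρ : ℝ≥0}
    (hρ : 0 < ρ) {z : SpaceTime d} (hz : z ∈ cylinder R 0) :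
    lmixed p q ((parBox z (3 * ρ)).indicator ((cylinder R 0).indicator f)) ≤
      6 ^ (d / p + 2 / q - β) * (lmorrey p q β (cylinder R 0) f * ((ρ : ℝ≥0∞) ^ (-β) *
        lmixed p q ((cylinder (ρ : ℝ≥0∞) z).indicator fun _ => 1))) := by
  have hbox := lmixed_parBox_le_lmorrey (f := f) hp hq β R (mul_pos three_pos hρ) hz
  rw [NNReal.coe_mul, NNReal.coe_ofNat] at hbox
  have hsix : ((2 * (3 * ρ) : ℝ≥0) : ℝ≥0∞) = 6 * ρ := by
    rw [← mul_assoc]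
    norm_num
  have hpow (s : ℝ) : (6 * (ρ : ℝ≥0∞)) ^ s = 6 ^ s * (ρ : ℝ≥0∞) ^ s :=
    ENNReal.mul_rpow_of_ne_top (by simp) ENNReal.coe_ne_top s
  refine hbox.trans_eq ?_
  rw [hsix, hpow, hpow, lmixed_indicator_cylinder_one hp hq hρ, sub_eq_add_neg,
    ENNReal.rpow_add (d / p + 2 / q) (-β) (by simp) (by simp)]
  ring

theorem lmixed_rpow_cylinder_one {κ : ℝ} (hκ : 0 < κ) (hr₂ : r₂ ≠ 0) (ρ : ℝ≥0)
    (z : SpaceTime d) :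
    lmixed (κ * r₁) (κ * r₂) ((cylinder (ρ : ℝ≥0∞) z).indicator fun _ => 1) ^ κ =
      lmixed r₁ r₂ ((cylinder (ρ : ℝ≥0∞) z).indicator fun _ => 1) := by
  rw [← lmixed_rpow hκ hr₂]
  congr 1 with w
  by_cases hw : w ∈ cylinder (ρ : ℝ≥0∞) z <;> simp [hw, hκ]

theorem exists_lmixed_parMax_rpow_le (d : ℕ) (hq₁ : 1 < q₁) (hq₂ : 1 < q₂) {κ : ℝ} (hκ : 0 < κ)
    (hr₁ : κ * r₁ = q₁) (hr₂ : κ * r₂ = q₂) (β : ℝ) : ∃ K : ℝ≥0∞, K ≠ ⊤ ∧ ∀ (R : ℝ≥0∞)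
      (f : SpaceTime d → ℝ≥0∞) (_ : Measurable f) (ρ : ℝ≥0) (_ : 0 < ρ) (z : SpaceTime d)
      (_ : z ∈ cylinder R 0),
      lmixed r₁ r₂ (fun w =>
          parMax ((parBox z (3 * ρ)).indicator ((cylinder R 0).indicator f)) w ^ κ) ≤
        K * lmorrey q₁ q₂ β (cylinder R 0) f ^ κ * ((ρ : ℝ≥0∞) ^ (-(κ * β)) *
          lmixed r₁ r₂ ((cylinder (ρ : ℝ≥0∞) z).indicator fun _ => 1)) := by
  obtain ⟨C, hC, hmax⟩ := exists_lmixed_parMax_le d hq₁ hq₂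
  have hr₂0 : r₂ ≠ 0 := by
    rintro rfl
    linarith
  refine ⟨(C * 6 ^ (d / q₁ + 2 / q₂ - β)) ^ κ, by finiteness, fun R f hf ρ hρ z hz => ?_⟩
  have hg := (hf.indicator (measurableSet_cylinder R 0)).indicator
    (measurableSet_parBox z (3 * ρ))
  have hbox := lmixed_parBox_three_mul_le (p := q₁) (q := q₂) (f := f) (by linarith) (by linarith)
    β R hρ hz
  rw [lmixed_rpow hκ hr₂0, ← lmixed_rpow_cylinder_one hκ hr₂0, hr₁, hr₂, neg_mul_eq_mul_neg,
    mul_comm κ, ENNReal.rpow_mul, ← ENNReal.mul_rpow_of_nonneg _ _ hκ.le,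
    ← ENNReal.mul_rpow_of_nonneg _ _ hκ.le, ← ENNReal.mul_rpow_of_nonneg _ _ hκ.le]
  gcongr
  exact (hmax _ hg).trans ((mul_le_mul' le_rfl hbox).trans_eq (by ring))

theorem lmixed_indicator_parPotential_le (hq₁ : 1 ≤ q₁) (hq₂ : 1 ≤ q₂) (hr₁ : 1 ≤ r₁)
    (hr₂ : 1 ≤ r₂) (hβ : 1 < β) (R : ℝ≥0∞) (hf : Measurable f) {ρ : ℝ≥0} (hρ : 0 < ρ)
    (z : SpaceTime d) :
    lmixed r₁ r₂ ((cylinder (ρ : ℝ≥0∞) z).indicator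
        ((cylinder R 0).indicator (parPotential ((cylinder R 0).indicator f)))) ≤
      ENNReal.ofReal (1 + 1 / (β - 1)) * parMaxConst d ^ (1 - 1 / β) *
          (potConst d β * lmorrey q₁ q₂ β (cylinder R 0) f) ^ (1 / β) *
          lmixed r₁ r₂ (fun w => parMax
            ((parBox z (3 * ρ)).indicator ((cylinder R 0).indicator f)) w ^ (1 - 1 / β)) +
        potConst d β * lmorrey q₁ q₂ β (cylinder R 0) f *
          (ENNReal.ofReal (1 / (β - 1)) * (ρ : ℝ≥0∞) ^ (-(β - 1))) *
          lmixed r₁ r₂ ((cylinder (ρ : ℝ≥0∞) z).indicator fun _ => 1) := by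
  have hκ : 0 ≤ 1 - 1 / β := sub_nonneg.2 ((div_le_one (by linarith)).2 hβ.le)
  have hr₁0 : 0 < r₁ := by linarith
  have hr₂0 : 0 < r₂ := by linarith
  have hmax : Measurable fun w => parMax
      ((parBox z (3 * ρ)).indicator ((cylinder R 0).indicator f)) w ^ (1 - 1 / β) :=
    (measurable_parMax ((hf.indicator (measurableSet_cylinder R 0)).indicator
      (measurableSet_parBox _ _))).pow_const _
  have hone : Measurable ((cylinder (ρ : ℝ≥0∞) z).indicator fun _ => (1 : ℝ≥0∞)) :=
    measurable_const.indicator (measurableSet_cylinder _ z)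
  rw [← lmixed_const_mul hr₁0 hr₂0 hmax, ← lmixed_const_mul hr₁0 hr₂0 hone]
  refine le_trans (lmixed_mono hr₁0.le hr₂0.le fun w => ?_) (lmixed_add_le hr₁ hr₂
    (hmax.const_mul _) (hone.const_mul _))
  rw [Set.indicator_indicator]
  by_cases hw : w ∈ cylinder (ρ : ℝ≥0∞) z ∩ cylinder R 0
  swap
  · exact (Set.indicator_of_notMem hw _).trans_le zero_le
  obtain ⟨hwC, hwR⟩ := hw
  simp only [Set.indicator_of_mem (Set.mem_inter hwC hwR), Set.indicator_of_mem hwC, mul_one]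
  refine (parPotential_le hq₁ hq₂ hβ R hf hρ hwR hwC).trans_eq ?_
  rw [ENNReal.mul_rpow_of_nonneg _ _ hκ]
  ring

theorem exists_lmorrey_parPotential_le (d : ℕ) (hq₁ : 1 < q₁) (hq₂ : 1 < q₂) (hβ : 1 < β)
    (hr₁ : r₁ * (β - 1) = q₁ * β) (hr₂ : r₂ * (β - 1) = q₂ * β) :
    ∃ K : ℝ≥0∞, K ≠ ⊤ ∧ ∀ (R : ℝ≥0∞) (f : SpaceTime d → ℝ≥0∞), Measurable f →
      lmorrey r₁ r₂ (β - 1) (cylinder R 0) (parPotential ((cylinder R 0).indicator f)) ≤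
        K * lmorrey q₁ q₂ β (cylinder R 0) f := by
  have hβ0 : 0 < β := by linarith
  have hκ : 0 < 1 - 1 / β := sub_pos.2 ((div_lt_one hβ0).2 hβ)
  have hr₁' : 1 < r₁ := by nlinarith
  have hr₂' : 1 < r₂ := by nlinarith
  obtain ⟨K, hK, hmax⟩ := exists_lmixed_parMax_rpow_le (r₁ := r₁) (r₂ := r₂) d hq₁ hq₂ hκ
    (by field_simp; linarith) (by field_simp; linarith) β
  refine ⟨ENNReal.ofReal (1 + 1 / (β - 1)) * parMaxConst d ^ (1 - 1 / β) *
    potConst d β ^ (1 / β) * K + potConst d β * ENNReal.ofReal (1 / (β - 1)), ?_,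
    fun R f hf => lmorrey_le_of_forall_lmixed_le (by linarith) (by linarith) fun ρ hρ z hz => ?_⟩
  · have := parMaxConst_ne_top d
    have := potConst_ne_top d β
    have : 0 ≤ 1 / β := by positivity
    finiteness
  refine (lmixed_indicator_parPotential_le hq₁.le hq₂.le hr₁'.le hr₂'.le hβ R hf hρ z).trans ?_
  grw [hmax R f hf ρ hρ z hz]
  refine le_of_eq ?_
  set Φ := lmorrey q₁ q₂ β (cylinder R 0) f
  have hsplit : Φ ^ (1 / β) * Φ ^ (1 - 1 / β) = Φ := by
    rw [← ENNReal.rpow_add_of_nonneg _ _ (by positivity) hκ.le, add_sub_cancel, ENNReal.rpow_one]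
  have hexp : -((1 - 1 / β) * β) = -(β - 1) := by
    field_simp
  rw [hexp, ENNReal.mul_rpow_of_nonneg _ _ (by positivity)]
  set N := (ρ : ℝ≥0∞) ^ (-(β - 1)) *
    lmixed r₁ r₂ ((cylinder (ρ : ℝ≥0∞) z).indicator fun _ => 1)
  calc _ = ENNReal.ofReal (1 + 1 / (β - 1)) * parMaxConst d ^ (1 - 1 / β) *
          potConst d β ^ (1 / β) * K * (Φ ^ (1 / β) * Φ ^ (1 - 1 / β)) * N +
        potConst d β * ENNReal.ofReal (1 / (β - 1)) * Φ * N := by ring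
    _ = _ := by
        rw [hsplit]
        ring

end Adams

section Gradient

variable {d : ℕ} {q₁ q₂ r₁ r₂ β : ℝ}

theorem inv_rpow_one_add_mul_rpow_sub_one_le (hβ : 1 < β) {R : ℝ≥0∞} (hR : 0 < R) :
    (R ^ (1 + β))⁻¹ * R ^ (β - 1) ≤ (R ^ 2)⁻¹ := by
  induction R with
  | top => simp [ENNReal.top_rpow_of_pos (by linarith : 0 < 1 + β)]
  | coe R =>
    rw [← ENNReal.rpow_neg, ← ENNReal.rpow_add _ _ hR.ne' ENNReal.coe_ne_top,
      show -(1 + β) + (β - 1) = -(2 : ℕ) by push_cast; ring, ENNReal.rpow_neg,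
      ENNReal.rpow_natCast]

theorem morreyExponent_sub_one_le (hq₁ : 0 < q₁) (hq₂ : 0 < q₂) (hβ : 1 < β)
    (hβ' : β ≤ d / q₁ + 2 / q₂) (hr₁ : r₁ * (β - 1) = q₁ * β) (hr₂ : r₂ * (β - 1) = q₂ * β) :
    β - 1 ≤ d / r₁ + 2 / r₂ := by
  have hβ0 : 0 < β - 1 := by linarith
  have hr₁0 : 0 < r₁ := by nlinarith
  have hr₂0 : 0 < r₂ := by nlinarith
  have h₁ : d / r₁ = (β - 1) / β * (d / q₁) := by
    field_simp
    linear_combination -(d : ℝ) * hr₁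
  have h₂ : 2 / r₂ = (β - 1) / β * (2 / q₂) := by
    field_simp
    linear_combination -hr₂
  calc β - 1 = (β - 1) / β * β := by field_simp
    _ ≤ (β - 1) / β * (d / q₁ + 2 / q₂) := by gcongr
    _ = d / r₁ + 2 / r₂ := by rw [h₁, h₂, mul_add]

theorem exists_lmorrey_spaceGrad_le (d : ℕ) (hq₁ : 1 < q₁) (hq₂ : 1 < q₂) (hβ : 1 < β)
    (hβ' : β ≤ d / q₁ + 2 / q₂) (hr₁ : r₁ * (β - 1) = q₁ * β) (hr₂ : r₂ * (β - 1) = q₂ * β) :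
    ∃ N : ℝ≥0∞, N ≠ ⊤ ∧ ∀ R : ℝ≥0∞, 0 < R → ∀ u : SpaceTime d → ℝ, ContDiff ℝ 2 u →
      (R = ⊤ → ∃ B : ℝ, ∀ z, ‖u z‖ ≤ B) →
        lmorrey r₁ r₂ (β - 1) (cylinder R 0) (fun z => ‖spaceGrad u z‖ₑ) ≤
          N * lmorrey q₁ q₂ β (cylinder R 0) (fun z => ‖heatSize u z‖ₑ) +
            N * (R ^ 2)⁻¹ * lmorrey q₁ q₂ β (cylinder R 0) (fun z => ‖u z‖ₑ) := by
  have hr₁' : 1 < r₁ := by nlinarith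
  have hr₂' : 1 < r₂ := by nlinarith
  have hr₁0 : 0 < r₁ := by linarith
  have hr₂0 : 0 < r₂ := by linarith
  obtain ⟨C, C', hC, hC', hgrad⟩ :=
    exists_enorm_spaceGrad_le_parPotential d hq₁.le hq₂.le (by linarith : 0 ≤ 1 + β)
  obtain ⟨K, hK, hAdams⟩ := exists_lmorrey_parPotential_le d hq₁ hq₂ hβ hr₁ hr₂
  refine ⟨C * K + C', by finiteness, fun R hR u hu hbdd => ?_⟩
  have hQ := measurableSet_cylinder R (0 : SpaceTime d)
  have hF : Measurable fun w => ‖heatSize u w‖ₑ := (continuous_heatSize hu).enorm.measurable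
  have hP := measurable_parPotential (hF.indicator hQ)
  set Φ := lmorrey q₁ q₂ β (cylinder R 0) fun w => ‖u w‖ₑ
  set Ψ := lmorrey q₁ q₂ β (cylinder R 0) fun w => ‖heatSize u w‖ₑ
  set P := parPotential ((cylinder R 0).indicator fun w => ‖heatSize u w‖ₑ)
  calc _ ≤ lmorrey r₁ r₂ (β - 1) (cylinder R 0)
          (fun z => C * P z + C' * ((R ^ (1 + β))⁻¹ * Φ) * 1) :=
        lmorrey_mono hr₁0.le hr₂0.le fun z hz => by
          simpa only [mul_one] using hgrad R hR u hu hbdd z hz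
    _ ≤ C * lmorrey r₁ r₂ (β - 1) (cylinder R 0) P + C' * ((R ^ (1 + β))⁻¹ * Φ) *
          lmorrey r₁ r₂ (β - 1) (cylinder R 0) (fun _ => 1) := by
        refine (lmorrey_add_le hr₁'.le hr₂'.le hQ (hP.const_mul _) measurable_const).trans ?_
        gcongr
        · exact lmorrey_const_mul_le hr₁0 hr₂0 hQ hP C
        · exact lmorrey_const_mul_le hr₁0 hr₂0 hQ measurable_const _
    _ ≤ C * (K * Ψ) + C' * ((R ^ (1 + β))⁻¹ * Φ) * R ^ (β - 1) := by
        gcongr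
        · exact hAdams R _ hF
        · exact lmorrey_cylinder_one_le hr₁0 hr₂0 (by linarith)
            (morreyExponent_sub_one_le (by linarith) (by linarith) hβ hβ' hr₁ hr₂) hR
    _ = C * K * Ψ + C' * ((R ^ (1 + β))⁻¹ * R ^ (β - 1)) * Φ := by ring
    _ ≤ (C * K + C') * Ψ + (C * K + C') * (R ^ 2)⁻¹ * Φ := by
        gcongr
        · exact le_self_add
        · exact le_add_self
        · exact inv_rpow_one_add_mul_rpow_sub_one_le hβ hR

end Gradient

end ParabolicMorrey

end

theorem theorem5p11_general (d : ℕ) (q₁ q₂ β r₁ r₂ : ℝ) (hq₁ : 1 < q₁) (hq₂ : 1 < q₂)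
    (hβ : 1 < β) (hβ' : β ≤ d / q₁ + 2 / q₂)
    (hr₁ : r₁ * (β - 1) = q₁ * β) (hr₂ : r₂ * (β - 1) = q₂ * β) :
    ∃ N : ℝ≥0, ∀ R : ℝ≥0∞, 0 < R → ∀ u : ParabolicMorrey.SpaceTime d → ℝ,
      ContDiff ℝ 2 u → (R = ⊤ → ∃ B : ℝ, ∀ z, ‖u z‖ ≤ B) →
        ParabolicMorrey.morreyNorm r₁ r₂ (β - 1) (ParabolicMorrey.cylinder R 0)
            (ParabolicMorrey.spaceGrad u) ≤
          N * ParabolicMorrey.morreyNorm q₁ q₂ β (ParabolicMorrey.cylinder R 0)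
              (fun z => |ParabolicMorrey.timeDeriv u z| + ‖ParabolicMorrey.spaceHess u z‖) +
            N * (R ^ 2)⁻¹ *
              ParabolicMorrey.morreyNorm q₁ q₂ β (ParabolicMorrey.cylinder R 0) u := by
  obtain ⟨N, hN, hbound⟩ :=
    ParabolicMorrey.exists_lmorrey_spaceGrad_le d hq₁ hq₂ hβ hβ' hr₁ hr₂
  refine ⟨N.toNNReal, fun R hR u hu hbdd => ?_⟩
  simpa only [ParabolicMorrey.morreyNorm_eq_lmorrey, ENNReal.coe_toNNReal hN] using
    hbound R hR u hu hbdd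

theorem theorem5p11 (d : ℕ) (hd : 1 ≤ d) (q₁ q₂ β r₁ r₂ : ℝ) (hq₁ : 1 < q₁) (hq₂ : 1 < q₂)
    (hβ : 1 < β) (hβ' : β ≤ d / q₁ + 2 / q₂)
    (hr₁ : r₁ * (β - 1) = q₁ * β) (hr₂ : r₂ * (β - 1) = q₂ * β) :
    ∃ N : ℝ≥0, ∀ R : ℝ≥0∞, 0 < R → ∀ u : ParabolicMorrey.SpaceTime d → ℝ,
      ContDiff ℝ (⊤ : ℕ∞) u → HasCompactSupport u →
        ParabolicMorrey.morreyNorm r₁ r₂ (β - 1) (ParabolicMorrey.cylinder R 0)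
            (ParabolicMorrey.spaceGrad u) ≤
          N * ParabolicMorrey.morreyNorm q₁ q₂ β (ParabolicMorrey.cylinder R 0)
              (fun z => |ParabolicMorrey.timeDeriv u z| + ‖ParabolicMorrey.spaceHess u z‖) +
            N * (R ^ 2)⁻¹ *
              ParabolicMorrey.morreyNorm q₁ q₂ β (ParabolicMorrey.cylinder R 0) u := by
  obtain ⟨N, hN⟩ := theorem5p11_general d q₁ q₂ β r₁ r₂ hq₁ hq₂ hβ hβ' hr₁ hr₂
  exact ⟨N, fun R hR u hu hsupp => hN R hR u (hu.of_le (by norm_cast)) fun _ =>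
    hsupp.exists_bound_of_continuous hu.continuous⟩
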